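/- Let $m\ge 0$ be an integer, let $A(n),B(n),C(n),W_1(n),W_2(n)$ ($n\in\mathbb Z$) be complex $m\times m$ matrices with $B(n),C(n)$ Hermitian and $W_1(n),W_2(n)\ge 0$, and put $$J=\begin{pmatrix}0&-I_m\\ I_m&0\end{pmatrix},\quad P(n)=\begin{pmatrix}-C(n)&A(n)^*\\ A(n)&B(n)\end{pmatrix},\quad W(n)=\mathrm{diag}(W_1(n),W_2(n)).$$ For $y=(u,v):\mathbb Z\to\mathbb C^m\times\mathbb C^m$ write $\Delta y(n)=y(n+1)-y(n)$, $R(y)(n)=(u(n+1),v(n))$ and $l(y)(n)=J\Delta y(n)-P(n)R(y)(n)$, and consider the system $$J\Delta y(n)=(P(n)+\lambda W(n))R(y)(n),\qquad n\in\mathbb Z. \tag{1}$$ Assume: ($B_1$) $I_m-A(n)$ is invertible for every $n\in\mathbb Z$. ($B_2$) There are integers $s^l\le t^l\le 0$ and $1\le s^r\le t^r$ such that for every $\lambda\in\mathbb C$ every non-trivial solution $y$ of (1) satisfies $$\sum_{n=s^l}^{t^l}R(y)(n)^*W(n)R(y)(n)>0,\qquad \sum_{n=s^r}^{t^r}R(y)(n)^*W(n)R(y)(n)>0.$$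 For an interval $I\subset\mathbb Z$ let $l^2_W(I)$ be the space of sequences with $\sum_{n\in I}R(y)(n)^*W(n)R(y)(n)<\infty$, modulo sequences of seminorm $0$, with inner product $\langle y,z\rangle=\sum_{n\in I}R(z)(n)^*W(n)R(y)(n)$. The maximal relation $\mathcal T(I)$ is the set of $(y,g)\in l^2_W(I)^2$ such that $y$ has a representative $\hat y$ with $l(\hat y)(n)=W(n)R(\hat g)(n)$, $n\in I$, for every representative $\hat g$ of $g$. For $I=\{n\le 0\}$ or $I=\{n\ge 1\}$ the minimal relation is the closure of the set of those $(y,g)$ for which $\hat y$ can moreover be chosen to be zero outside a finite set and at $n=1$. Assume that $-\infty$ and $+\infty$ are in the limit circle case: for the minimal relation $T$ on $\{n\le0\}$, and for that on $\{n\ge1\}$, both defect indices $\dim\{g-\lambda f:(f,g)\in T\}^\perp$, $\lambda=\pm i$, equal $2m$. Let $\theta_{1,\lambda},\dots,\theta_{2m,\lambda}$ be the solutions of (1) with $(\theta_{1,\lambda}(0),\dots,\theta_{2m,\lambda}(0))=I_{2m}$, put $\theta_j=\theta_{j,0}$ and $(x,y)_d(n)=y(n)^*Jx(n)$, let $\Theta_\lambda(n)$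 be the $2m\times 2m$ matrix with entry $(\theta_{j,\lambda},\theta_i)_d(n)$ in row $i$ and column $j$, and let $\Theta_\lambda(\pm\infty)=\lim_{n\to\pm\infty}\Theta_\lambda(n)$. Let $M,N$ be complex $2m\times2m$ matrices with $\mathrm{rank}(M,N)=2m$ and $MJM^*=NJN^*$. Let $\mathcal T_D$ be the linear relation of all $(y,g)\in\mathcal T(\mathbb Z)$ whose representative $\hat y$ as above satisfies $$M\big((\hat y,\theta_j)_d(-\infty)\big)_{j=1}^{2m}-N\big((\hat y,\theta_j)_d(+\infty)\big)_{j=1}^{2m}=0,$$ where $(\hat y,\theta_j)_d(\pm\infty)=\lim_{n\to\pm\infty}(\hat y,\theta_j)_d(n)$. Put $\Gamma_d(\lambda)=\det\big(M\Theta_\lambda(-\infty)-N\Theta_\lambda(+\infty)\big)$. Then the limits $\Theta_\lambda(\pm\infty)$ exist for every $\lambda\in\mathbb C$, the function $\Gamma_d$ is entire, and for every eigenvalue $\lambda_*$ of $\mathcal T_D$ (that is, $N(\mathcal T_D-\lambda_*I)=\{f:(f,\lambda_*f)\in\mathcal T_D\}\ne\{0\}$) the analytic and geometric multiplicities are equal: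 $\dim N(\mathcal T_D-\lambda_*I)$ is finite and equals the order of $\lambda_*$ as a zero of $\Gamma_d$. -/

import Mathlib

open Filter Topology
open scoped Matrix ComplexOrder

noncomputable section

namespace DiscreteHamiltonian

/-- `ℂ^{2m}`, a vector being written `(u, v)` with `u, v ∈ ℂ^m`. -/
abbrev Vec (m : ℕ) : Type := Fin m ⊕ Fin m → ℂ

/-- Square complex matrices of size `2m`, in `m × m` blocks. -/
abbrev Mat (m : ℕ) : Type := Matrix (Fin m ⊕ Fin m) (Fin m ⊕ Fin m) ℂ

/-- The coefficients of a discrete linear Hamiltonian system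
`J Δy(n) = (P(n) + λ W(n)) R(y)(n)` on `ℤ`. The matrix `P(n)` is Hermitian exactly when
`B(n)` and `C(n)` are. -/
structure System (m : ℕ) where
  (A B C W₁ W₂ : ℤ → Matrix (Fin m) (Fin m) ℂ)
  isHermitian_B : ∀ n, (B n).IsHermitian
  isHermitian_C : ∀ n, (C n).IsHermitian
  posSemidef_W₁ : ∀ n, (W₁ n).PosSemidef
  posSemidef_W₂ : ∀ n, (W₂ n).PosSemidef

/-- The symplectic matrix `J = (0, -I; I, 0)`. -/
abbrev J (m : ℕ) : Mat m := Matrix.J (Fin m) ℂ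

/-- The partial right shift `R(y)(n) = (u(n+1), v(n))` for `y(n) = (u(n), v(n))`. -/
def R {m : ℕ} (y : ℤ → Vec m) (n : ℤ) : Vec m :=
  Sum.elim (fun i => y (n + 1) (Sum.inl i)) (fun i => y n (Sum.inr i))

/-- The bracket `(x, y)_d(n) = y(n)^* J x(n)`. -/
def bracket {m : ℕ} (x y : ℤ → Vec m) (n : ℤ) : ℂ :=
  star (y n) ⬝ᵥ (J m *ᵥ x n)

theorem R_add {m : ℕ} (y z : ℤ → Vec m) (n : ℤ) : R (y + z) n = R y n + R z n := by
  ext i; cases i <;> simp [R]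

theorem R_sub {m : ℕ} (y z : ℤ → Vec m) (n : ℤ) : R (y - z) n = R y n - R z n := by
  ext i; cases i <;> simp [R]

theorem R_smul {m : ℕ} (c : ℂ) (y : ℤ → Vec m) (n : ℤ) : R (c • y) n = c • R y n := by
  ext i; cases i <;> simp [R]

theorem R_zero {m : ℕ} (n : ℤ) : R (0 : ℤ → Vec m) n = 0 := by
  ext i; cases i <;> simp [R]

theorem bracket_add {m : ℕ} (x z y : ℤ → Vec m) (n : ℤ) :
    bracket (x + z) y n = bracket x y n + bracket z y n := by
  simp [bracket, Matrix.mulVec_add]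

theorem bracket_smul {m : ℕ} (c : ℂ) (x y : ℤ → Vec m) (n : ℤ) :
    bracket (c • x) y n = c * bracket x y n := by
  simp [bracket, Matrix.mulVec_smul]

namespace System

variable {m : ℕ} (S : System m)

/-- `P(n) = (-C(n), A(n)^*; A(n), B(n))`. -/
def P (n : ℤ) : Mat m := Matrix.fromBlocks (-S.C n) (S.A n)ᴴ (S.A n) (S.B n)

/-- `W(n) = diag(W₁(n), W₂(n))`. -/
def W (n : ℤ) : Mat m := Matrix.fromBlocks (S.W₁ n) 0 0 (S.W₂ n)

/-- `l(y)(n) = J Δy(n) - P(n) R(y)(n)`. -/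
def l (y : ℤ → Vec m) (n : ℤ) : Vec m :=
  J m *ᵥ (y (n + 1) - y n) - S.P n *ᵥ R y n

/-- `y` solves the system with spectral parameter `lam` on all of `ℤ`. -/
def IsSolution (lam : ℂ) (y : ℤ → Vec m) : Prop :=
  ∀ n, J m *ᵥ (y (n + 1) - y n) = (S.P n + lam • S.W n) *ᵥ R y n

/-- `I - A(n)` is invertible for every `n`. -/
def CondB1 : Prop := ∀ n, IsUnit (1 - S.A n)

/-- The definiteness condition on both half lines. -/
def CondB2 : Prop :=
  ∃ sl tl sr tr : ℤ, sl ≤ tl ∧ tl ≤ 0 ∧ 1 ≤ sr ∧ sr ≤ tr ∧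
    ∀ (lam : ℂ) (y : ℤ → Vec m), S.IsSolution lam y → y ≠ 0 →
      0 < ∑ n ∈ Finset.Icc sl tl, (star (R y n) ⬝ᵥ (S.W n *ᵥ R y n)).re ∧
      0 < ∑ n ∈ Finset.Icc sr tr, (star (R y n) ⬝ᵥ (S.W n *ᵥ R y n)).re

/-! ### The space `l²_W(I)` -/

/-- The sesquilinear density `R(y)(n)^* W(n) R(z)(n)`. -/
def dens (y z : ℤ → Vec m) (n : ℤ) : ℂ := star (R y n) ⬝ᵥ (S.W n *ᵥ R z n)

theorem isHermitian_W (n : ℤ) : (S.W n).IsHermitian := by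
  refine Matrix.IsHermitian.fromBlocks (S.posSemidef_W₁ n).isHermitian ?_
    (S.posSemidef_W₂ n).isHermitian
  simp

theorem posSemidef_W (n : ℤ) : (S.W n).PosSemidef := by
  refine Matrix.PosSemidef.of_dotProduct_mulVec_nonneg (S.isHermitian_W n) fun x => ?_
  have h1 := (S.posSemidef_W₁ n).dotProduct_mulVec_nonneg (x ∘ Sum.inl)
  have h2 := (S.posSemidef_W₂ n).dotProduct_mulVec_nonneg (x ∘ Sum.inr)
  have : star x ⬝ᵥ (S.W n *ᵥ x) = star (x ∘ Sum.inl) ⬝ᵥ (S.W₁ n *ᵥ (x ∘ Sum.inl))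
      + star (x ∘ Sum.inr) ⬝ᵥ (S.W₂ n *ᵥ (x ∘ Sum.inr)) := by
    simp [W, Matrix.fromBlocks_mulVec, dotProduct, Fintype.sum_sum_type]
  rw [this]
  exact add_nonneg h1 h2

theorem dens_conj (y z : ℤ → Vec m) (n : ℤ) :
    (starRingEnd ℂ) (S.dens z y n) = S.dens y z n := by
  have h : star (star (R z n) ⬝ᵥ (S.W n *ᵥ R y n)) = star (R y n) ⬝ᵥ (S.W n *ᵥ R z n) := by
    rw [Matrix.star_dotProduct, star_star, Matrix.star_mulVec, (S.isHermitian_W n).eq,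
      Matrix.dotProduct_mulVec]
  exact h

theorem dens_add_left (x y z : ℤ → Vec m) (n : ℤ) :
    S.dens (x + y) z n = S.dens x z n + S.dens y z n := by
  simp [dens, R_add]

theorem dens_add_right (x y z : ℤ → Vec m) (n : ℤ) :
    S.dens x (y + z) n = S.dens x y n + S.dens x z n := by
  simp [dens, R_add, Matrix.mulVec_add]

theorem dens_smul_left (c : ℂ) (x y : ℤ → Vec m) (n : ℤ) :
    S.dens (c • x) y n = (starRingEnd ℂ) c * S.dens x y n := by
  simp [dens, R_smul]

theorem dens_smul_right (c : ℂ) (x y : ℤ → Vec m) (n : ℤ) :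
    S.dens x (c • y) n = c * S.dens x y n := by
  simp [dens, R_smul, Matrix.mulVec_smul]

theorem dens_self_nonneg (y : ℤ → Vec m) (n : ℤ) : 0 ≤ (S.dens y y n).re :=
  (Complex.le_def.1 ((S.posSemidef_W n).dotProduct_mulVec_nonneg (R y n))).1

theorem dens_self_im (y : ℤ → Vec m) (n : ℤ) : (S.dens y y n).im = 0 :=
  Complex.conj_eq_iff_im.1 (S.dens_conj y y n)

theorem ofReal_dens_self (y : ℤ → Vec m) (n : ℤ) :
    (((S.dens y y n).re : ℝ) : ℂ) = S.dens y y n :=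
  Complex.ext (by simp) (by simp [S.dens_self_im])

/-- The space of sequences that are square summable over the index set `I` with weight `W`.
Sequences are indexed by all of `ℤ`; for `I ≠ ℤ` the values that do not enter
`R(y)(n)`, `n ∈ I`, have no influence on the seminorm. -/
def preL2 (I : Set ℤ) : Submodule ℂ (ℤ → Vec m) where
  carrier := {y | Summable fun n : I => (S.dens y y n).re}
  zero_mem' := by
    have : (fun n : I => (S.dens (0 : ℤ → Vec m) 0 n).re) = fun _ => 0 := by
      ext n; simp [dens, R_zero]
    simp only [Set.mem_ofPred_eq, this]
    exact summable_zero
  add_mem' := by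
    intro a b ha hb
    refine Summable.of_nonneg_of_le (fun n => S.dens_self_nonneg _ _) (fun n => ?_)
      ((ha.mul_left 2).add (hb.mul_left 2))
    have h := S.dens_self_nonneg (a + (-1 : ℂ) • b) n
    simp only [dens_add_left, dens_add_right, dens_smul_left, dens_smul_right, map_neg, map_one,
      Complex.add_re, neg_mul, one_mul, Complex.neg_re] at h ⊢
    linarith
  smul_mem' := by
    intro c y hy
    have : (fun n : I => (S.dens (c • y) (c • y) n).re)
        = fun n : I => Complex.normSq c * (S.dens y y n).re := by
      ext n
      rw [dens_smul_left, dens_smul_right, ← mul_assoc, mul_comm _ c, Complex.mul_conj]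
      simp
    simp only [Set.mem_ofPred_eq, this]
    exact hy.mul_left _

/-- `l̂²_W(I)` as a type of its own, to carry the seminorm. -/
def PreL2 (I : Set ℤ) : Type := S.preL2 I

instance (I : Set ℤ) : AddCommGroup (S.PreL2 I) := inferInstanceAs (AddCommGroup (S.preL2 I))

instance (I : Set ℤ) : Module ℂ (S.PreL2 I) := inferInstanceAs (Module ℂ (S.preL2 I))

/-- The inclusion of `l̂²_W(I)` in the space of all sequences. -/
def seq (I : Set ℤ) : S.PreL2 I →ₗ[ℂ] (ℤ → Vec m) := (S.preL2 I).subtype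

theorem summable_dens_self {I : Set ℤ} (y : S.PreL2 I) :
    Summable fun n : I => S.dens (S.seq I y) (S.seq I y) n := by
  have h : Summable fun n : I => (S.dens (S.seq I y) (S.seq I y) n).re := y.2
  have h2 := Complex.ofRealCLM.summable h
  refine h2.congr fun n => ?_
  exact S.ofReal_dens_self _ _

theorem summable_dens {I : Set ℤ} (y z : S.PreL2 I) :
    Summable fun n : I => S.dens (S.seq I y) (S.seq I z) n := by
  have h0 := S.summable_dens_self (y + z)
  have h1 := S.summable_dens_self (y + (-1 : ℂ) • z)
  have h2 := S.summable_dens_self (y + Complex.I • z)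
  have h3 := S.summable_dens_self (y + (-Complex.I) • z)
  have h := (((h0.sub h1).sub (h2.mul_left Complex.I)).add (h3.mul_left Complex.I)).mul_left (1 / 4)
  refine h.congr fun n => ?_
  simp only [map_add, map_smul, dens_add_left, dens_add_right, dens_smul_left, dens_smul_right,
    map_neg, map_one, Complex.conj_I]
  ring_nf
  simp only [Complex.I_sq]
  ring

/-- The semi-inner product `∑_{n ∈ I} R(y)(n)^* W(n) R(z)(n)`, conjugate linear in the first
argument (Mathlib's convention). -/
@[reducible] def core (I : Set ℤ) : PreInnerProductSpace.Core ℂ (S.PreL2 I) where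
  inner y z := ∑' n : I, S.dens (S.seq I y) (S.seq I z) n
  conj_inner_symm y z := by
    rw [Complex.conj_tsum]
    exact tsum_congr fun n => S.dens_conj _ _ _
  re_inner_nonneg y := by
    change 0 ≤ (∑' n : I, S.dens (S.seq I y) (S.seq I y) n).re
    rw [Complex.re_tsum (S.summable_dens_self y)]
    exact tsum_nonneg fun n => S.dens_self_nonneg _ _
  add_left x y z := by
    rw [← (S.summable_dens x z).tsum_add (S.summable_dens y z)]
    exact tsum_congr fun n => by rw [map_add, dens_add_left]
  smul_left x y c := by
    rw [← tsum_mul_left]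
    exact tsum_congr fun n => by rw [map_smul, dens_smul_left]

instance (I : Set ℤ) : SeminormedAddCommGroup (S.PreL2 I) :=
  @InnerProductSpace.Core.toSeminormedAddCommGroup ℂ _ _ _ _ (S.core I)

instance (I : Set ℤ) : InnerProductSpace ℂ (S.PreL2 I) := InnerProductSpace.ofCore (S.core I)

/-- The space `l²_W(I)`: sequences modulo those of seminorm zero. -/
abbrev L2 (I : Set ℤ) : Type := SeparationQuotient (S.PreL2 I)

/-- The class in `l²_W(I)` of a sequence. -/
def cls (I : Set ℤ) : S.PreL2 I →ₗ[ℂ] S.L2 I := (SeparationQuotient.mkCLM ℂ (S.PreL2 I)).toLinearMap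

theorem cls_surjective (I : Set ℤ) : Function.Surjective (S.cls I) :=
  SeparationQuotient.surjective_mk

theorem inner_eq (I : Set ℤ) (y z : S.PreL2 I) :
    inner ℂ (S.cls I y) (S.cls I z) = ∑' n : I, S.dens (S.seq I y) (S.seq I z) n := rfl

theorem W_mulVec_R_of_cls_eq_zero {I : Set ℤ} {g : S.PreL2 I} (hg : S.cls I g = 0) {n : ℤ}
    (hn : n ∈ I) : S.W n *ᵥ R (S.seq I g) n = 0 := by
  have h0 : (∑' n : I, S.dens (S.seq I g) (S.seq I g) n) = 0 := by
    rw [← S.inner_eq, hg, inner_zero_left]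
  have h1 : (∑' n : I, (S.dens (S.seq I g) (S.seq I g) n).re) = 0 := by
    rw [← Complex.re_tsum (S.summable_dens_self g), h0, Complex.zero_re]
  have h2 := ((hasSum_zero_iff_of_nonneg fun n : I =>
    S.dens_self_nonneg (S.seq I g) n).1 (h1 ▸ Summable.hasSum g.2))
  have h3 : (S.dens (S.seq I g) (S.seq I g) n).re = 0 := congrFun h2 ⟨n, hn⟩
  have h4 : S.dens (S.seq I g) (S.seq I g) n = 0 := by
    rw [← S.ofReal_dens_self, h3, Complex.ofReal_zero]
  exact ((S.posSemidef_W n).dotProduct_mulVec_zero_iff _).1 h4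

/-! ### Linear relations in `l²_W(I)` -/

/-- The relation of all pairs of classes `(y, g)` such that some representative `ŷ` of `y`, lying
in the given space `D` of sequences, satisfies `l(ŷ)(n) = W(n) R(ĝ)(n)`, `n ∈ I`, for every
representative `ĝ` of `g`. -/
def relation (I : Set ℤ) (D : Submodule ℂ (ℤ → Vec m)) : Submodule ℂ (S.L2 I × S.L2 I) where
  carrier := {p | ∃ y : S.PreL2 I, S.cls I y = p.1 ∧ S.seq I y ∈ D ∧
    ∀ g : S.PreL2 I, S.cls I g = p.2 → ∀ n ∈ I, S.l (S.seq I y) n = S.W n *ᵥ R (S.seq I g) n}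
  zero_mem' := by
    refine ⟨0, map_zero _, by rw [map_zero]; exact D.zero_mem, fun g hg n hn => ?_⟩
    rw [S.W_mulVec_R_of_cls_eq_zero hg hn]
    simp [l, R_zero]
  add_mem' := by
    rintro p q ⟨y, hy, hyD, hyg⟩ ⟨z, hz, hzD, hzg⟩
    refine ⟨y + z, by simp [hy, hz], by rw [map_add]; exact D.add_mem hyD hzD,
      fun g hg n hn => ?_⟩
    obtain ⟨a, ha⟩ := S.cls_surjective I p.2
    have h1 := hyg a ha n hn
    have h2 := hzg (g - a) (by rw [map_sub, hg, ha]; simp) n hn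
    rw [map_sub, R_sub, Matrix.mulVec_sub] at h2
    have h3 : S.l (S.seq I (y + z)) n = S.l (S.seq I y) n + S.l (S.seq I z) n := by
      simp only [l, map_add, R_add, Pi.add_apply, Matrix.mulVec_add, Matrix.mulVec_sub]
      abel
    rw [h3, h1, h2]
    abel
  smul_mem' := by
    rintro c p ⟨y, hy, hyD, hyg⟩
    refine ⟨c • y, by simp [hy], by rw [map_smul]; exact D.smul_mem c hyD, fun g hg n hn => ?_⟩
    obtain ⟨a, ha⟩ := S.cls_surjective I p.2
    have h1 := hyg a ha n hn
    have h2 := S.W_mulVec_R_of_cls_eq_zero (g := g - c • a)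
      (by rw [map_sub, map_smul, hg, ha]; simp) hn
    rw [map_sub, map_smul, R_sub, R_smul, Matrix.mulVec_sub, Matrix.mulVec_smul, sub_eq_zero] at h2
    have h3 : S.l (S.seq I (c • y)) n = c • S.l (S.seq I y) n := by
      simp only [l, map_smul, R_smul, Pi.smul_apply, Matrix.mulVec_smul, ← smul_sub]
    rw [h3, h1, h2]

/-- The maximal relation. -/
def maximal (I : Set ℤ) : Submodule ℂ (S.L2 I × S.L2 I) := S.relation I ⊤

end System

/-- Sequences with compact support in the interior of `I`, where a node `n` is interior when both
`n - 1` and `n` lie in `I`. For `I = ℤ` this is no restriction beyond compact support, and for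
`I = {n ≤ 0}` or `I = {n ≥ 1}` it says that `y` vanishes at the finite end `n = 1`
(and, without effect, at the nodes beyond it). -/
def compactlySupported (m : ℕ) (I : Set ℤ) : Submodule ℂ (ℤ → Vec m) where
  carrier := {y | (∃ s k : ℤ, s ≤ k ∧ ∀ n, (n ≤ s ∨ k + 1 ≤ n) → y n = 0) ∧
    ∀ n, (n - 1 ∉ I ∨ n ∉ I) → y n = 0}
  zero_mem' := ⟨⟨0, 0, le_rfl, fun _ _ => rfl⟩, fun _ _ => rfl⟩
  add_mem' := by
    rintro a b ⟨⟨s, k, hsk, ha⟩, ha'⟩ ⟨⟨s', k', _, hb⟩, hb'⟩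
    refine ⟨⟨min s s', max k k', by omega, fun n hn => ?_⟩, fun n hn => ?_⟩
    · rw [Pi.add_apply, ha n (by omega), hb n (by omega), add_zero]
    · rw [Pi.add_apply, ha' n hn, hb' n hn, add_zero]
  smul_mem' := by
    rintro c a ⟨⟨s, k, hsk, ha⟩, ha'⟩
    refine ⟨⟨s, k, hsk, fun n hn => ?_⟩, fun n hn => ?_⟩
    · rw [Pi.smul_apply, ha n hn, smul_zero]
    · rw [Pi.smul_apply, ha' n hn, smul_zero]

/-- The eigenspace `N(T - lam I) = {f | (f, lam f) ∈ T}` of a linear relation `T`. -/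
def eigenspace {E : Type*} [AddCommGroup E] [Module ℂ E] (T : Submodule ℂ (E × E)) (lam : ℂ) :
    Submodule ℂ E :=
  T.comap (LinearMap.prod LinearMap.id (lam • LinearMap.id))

/-- `lam` is an eigenvalue of the linear relation `T`. -/
def IsEigenvalue {E : Type*} [AddCommGroup E] [Module ℂ E] (T : Submodule ℂ (E × E)) (lam : ℂ) :
    Prop :=
  eigenspace T lam ≠ ⊥

/-- The range `{g - lam f | (f, g) ∈ T}` of `T - lam I`. -/
def rangeSub {E : Type*} [AddCommGroup E] [Module ℂ E] (T : Submodule ℂ (E × E)) (lam : ℂ) :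
    Submodule ℂ E :=
  T.map (LinearMap.snd ℂ E E - lam • LinearMap.fst ℂ E E)

/-- The defect index `dim R(T - lam I)^⊥` of a linear relation `T`. -/
def defectIndex {E : Type*} [NormedAddCommGroup E] [InnerProductSpace ℂ E]
    (T : Submodule ℂ (E × E)) (lam : ℂ) : Cardinal :=
  Module.rank ℂ (rangeSub T lam)ᗮ

namespace System

variable {m : ℕ} (S : System m)

/-- The pre-minimal relation. -/
def preMinimal (I : Set ℤ) : Submodule ℂ (S.L2 I × S.L2 I) :=
  S.relation I (compactlySupported m I)

/-- The minimal relation, the closure of the pre-minimal one. -/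
def minimal (I : Set ℤ) : Submodule ℂ (S.L2 I × S.L2 I) :=
  (S.preMinimal I).topologicalClosure

/-- The limit circle case at `-∞`: both defect indices of the left minimal relation are `2m`. -/
def LimitCircleAtBot : Prop :=
  defectIndex (S.minimal (Set.Iic 0)) Complex.I = ((2 * m : ℕ) : Cardinal) ∧
  defectIndex (S.minimal (Set.Iic 0)) (-Complex.I) = ((2 * m : ℕ) : Cardinal)

/-- The limit circle case at `+∞`: both defect indices of the right minimal relation are `2m`. -/
def LimitCircleAtTop : Prop :=
  defectIndex (S.minimal (Set.Ici 1)) Complex.I = ((2 * m : ℕ) : Cardinal) ∧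
  defectIndex (S.minimal (Set.Ici 1)) (-Complex.I) = ((2 * m : ℕ) : Cardinal)

/-! ### The fundamental solutions -/

/-- The value at `n + 1` of the solution whose value at `n` is `x`. -/
def stepUp (lam : ℂ) (n : ℤ) (x : Vec m) : Vec m :=
  let u : Fin m → ℂ := (1 - S.A n)⁻¹ *ᵥ
    (x ∘ Sum.inl + (S.B n + lam • S.W₂ n) *ᵥ (x ∘ Sum.inr))
  Sum.elim u ((1 - S.A n)ᴴ *ᵥ (x ∘ Sum.inr) + (S.C n - lam • S.W₁ n) *ᵥ u)

/-- The value at `n` of the solution whose value at `n + 1` is `x`. -/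
def stepDown (lam : ℂ) (n : ℤ) (x : Vec m) : Vec m :=
  let v : Fin m → ℂ := ((1 - S.A n)ᴴ)⁻¹ *ᵥ
    (x ∘ Sum.inr - (S.C n - lam • S.W₁ n) *ᵥ (x ∘ Sum.inl))
  Sum.elim ((1 - S.A n) *ᵥ (x ∘ Sum.inl) - (S.B n + lam • S.W₂ n) *ᵥ v) v

/-- Under the invertibility condition, the solution `y` with `y(0) = x`. -/
def sol (lam : ℂ) (x : Vec m) : ℤ → Vec m
  | Int.ofNat k => Nat.rec x (fun j z => S.stepUp lam (j : ℤ) z) k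
  | Int.negSucc k => Nat.rec (S.stepDown lam (-1) x)
      (fun j z => S.stepDown lam (Int.negSucc (j + 1)) z) k

theorem sol_zero (lam : ℂ) (x : Vec m) : S.sol lam x 0 = x := rfl

/-- The equation at one node, in block form. -/
theorem step_iff (lam : ℂ) (n : ℤ) (y : ℤ → Vec m) :
    J m *ᵥ (y (n + 1) - y n) = (S.P n + lam • S.W n) *ᵥ R y n ↔
      ((1 - S.A n) *ᵥ (y (n + 1) ∘ Sum.inl)
          = y n ∘ Sum.inl + (S.B n + lam • S.W₂ n) *ᵥ (y n ∘ Sum.inr)) ∧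
        y (n + 1) ∘ Sum.inr = (1 - S.A n)ᴴ *ᵥ (y n ∘ Sum.inr)
          + (S.C n - lam • S.W₁ n) *ᵥ (y (n + 1) ∘ Sum.inl) := by
  have h : S.P n + lam • S.W n = Matrix.fromBlocks (-S.C n + lam • S.W₁ n) (S.A n)ᴴ (S.A n)
      (S.B n + lam • S.W₂ n) := by
    simp [P, W, Matrix.fromBlocks_smul, Matrix.fromBlocks_add]
  have hR1 : R y n ∘ Sum.inl = y (n + 1) ∘ Sum.inl := rfl
  have hR2 : R y n ∘ Sum.inr = y n ∘ Sum.inr := rfl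
  have hs1 : (y (n + 1) - y n) ∘ Sum.inl = y (n + 1) ∘ Sum.inl - y n ∘ Sum.inl := rfl
  have hs2 : (y (n + 1) - y n) ∘ Sum.inr = y (n + 1) ∘ Sum.inr - y n ∘ Sum.inr := rfl
  have hJ : J m = Matrix.fromBlocks 0 (-1) 1 0 := rfl
  rw [h, hJ, Matrix.fromBlocks_mulVec, Matrix.fromBlocks_mulVec, hR1, hR2, hs1, hs2]
  generalize y (n + 1) ∘ Sum.inl = u'
  generalize y (n + 1) ∘ Sum.inr = v'
  generalize y n ∘ Sum.inl = u
  generalize y n ∘ Sum.inr = v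
  simp only [Matrix.zero_mulVec, Matrix.neg_mulVec, Matrix.one_mulVec, zero_add, add_zero,
    Matrix.add_mulVec, Matrix.sub_mulVec, Matrix.conjTranspose_sub, Matrix.conjTranspose_one]
  rw [Sum.elim_eq_iff]
  constructor
  · rintro ⟨h1, h2⟩
    constructor
    · linear_combination h2
    · linear_combination -h1
  · rintro ⟨h1, h2⟩
    constructor
    · linear_combination -h2
    · linear_combination h1

/-- Under the invertibility condition, `sol lam x` solves the system. -/
theorem sol_isSolution (h : S.CondB1) (lam : ℂ) (x : Vec m) : S.IsSolution lam (S.sol lam x) := by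
  have hA : ∀ n, IsUnit (1 - S.A n).det := fun n => (Matrix.isUnit_iff_isUnit_det _).1 (h n)
  have hA' : ∀ n, IsUnit ((1 - S.A n)ᴴ).det := fun n => by
    rw [Matrix.det_conjTranspose]; exact (hA n).star
  have key_up : ∀ (y : ℤ → Vec m) (n : ℤ), y (n + 1) = S.stepUp lam n (y n) →
      J m *ᵥ (y (n + 1) - y n) = (S.P n + lam • S.W n) *ᵥ R y n := by
    intro y n hy
    rw [step_iff, hy]
    simp only [stepUp, Sum.elim_comp_inl, Sum.elim_comp_inr, Matrix.mulVec_mulVec,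
      Matrix.mul_nonsing_inv _ (hA n), Matrix.one_mulVec, and_self]
  have key_down : ∀ (y : ℤ → Vec m) (n : ℤ), y n = S.stepDown lam n (y (n + 1)) →
      J m *ᵥ (y (n + 1) - y n) = (S.P n + lam • S.W n) *ᵥ R y n := by
    intro y n hy
    rw [step_iff, hy]
    simp only [stepDown, Sum.elim_comp_inl, Sum.elim_comp_inr, Matrix.mulVec_mulVec,
      Matrix.mul_nonsing_inv _ (hA' n), Matrix.one_mulVec]
    constructor
    · abel
    · abel
  intro n
  cases n with
  | ofNat k => exact key_up _ _ rfl
  | negSucc k =>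
    refine key_down _ _ ?_
    cases k with
    | zero => rfl
    | succ j => rfl

/-- The solution `θ_{j,lam}`: the columns of the fundamental matrix equal to `I` at `n = 0`. -/
def theta (lam : ℂ) (j : Fin m ⊕ Fin m) : ℤ → Vec m := S.sol lam (Pi.single j 1)

/-- `Θ_lam(n)`, with entries `(θ_{j,lam}, θ_{i,0})_d(n)` in row `i` and column `j`. -/
def Theta (lam : ℂ) (n : ℤ) : Mat m :=
  Matrix.of fun i j => bracket (S.theta lam j) (S.theta 0 i) n

/-- `Θ_lam(-∞)`. -/
def ThetaBot (lam : ℂ) : Mat m := limUnder atBot (S.Theta lam)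

/-- `Θ_lam(+∞)`. -/
def ThetaTop (lam : ℂ) : Mat m := limUnder atTop (S.Theta lam)

/-- `Γ_d(lam) = det (M Θ_lam(-∞) - N Θ_lam(+∞))`. -/
def Gamma (M N : Mat m) (lam : ℂ) : ℂ := (M * S.ThetaBot lam - N * S.ThetaTop lam).det

/-! ### The self-adjoint relation given by boundary conditions -/

/-- The sequences `y` whose brackets with the `θ_j = θ_{j,0}` have limits at `±∞` satisfying
`M (y, θ_j)_d(-∞) - N (y, θ_j)_d(+∞) = 0`. -/
def boundaryCondition (M N : Mat m) : Submodule ℂ (ℤ → Vec m) where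
  carrier := {y | ∃ a b : Vec m,
    Tendsto (fun n i => bracket y (S.theta 0 i) n) atBot (𝓝 a) ∧
    Tendsto (fun n i => bracket y (S.theta 0 i) n) atTop (𝓝 b) ∧
    M *ᵥ a - N *ᵥ b = 0}
  zero_mem' := by
    refine ⟨0, 0, ?_, ?_, by simp⟩
    · refine (tendsto_const_nhds (x := (0 : Vec m)) (f := (atBot : Filter ℤ))).congr fun n => ?_
      ext i; simp [bracket]
    · refine (tendsto_const_nhds (x := (0 : Vec m)) (f := (atTop : Filter ℤ))).congr fun n => ?_
      ext i; simp [bracket]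
  add_mem' := by
    rintro y z ⟨a, b, ha, hb, h⟩ ⟨a', b', ha', hb', h'⟩
    refine ⟨a + a', b + b', ?_, ?_, ?_⟩
    · refine (ha.add ha').congr fun n => ?_
      ext i; simp [bracket_add]
    · refine (hb.add hb').congr fun n => ?_
      ext i; simp [bracket_add]
    · rw [Matrix.mulVec_add, Matrix.mulVec_add, add_sub_add_comm, h, h', add_zero]
  smul_mem' := by
    rintro c y ⟨a, b, ha, hb, h⟩
    refine ⟨c • a, c • b, ?_, ?_, ?_⟩
    · refine (ha.const_smul c).congr fun n => ?_
      ext i; simp [bracket_smul]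
    · refine (hb.const_smul c).congr fun n => ?_
      ext i; simp [bracket_smul]
    · rw [Matrix.mulVec_smul, Matrix.mulVec_smul, ← smul_sub, h, smul_zero]

/-- The relation `T_D` of all pairs in the maximal relation on `ℤ` that satisfy the boundary
condition given by `M` and `N`. -/
def TD (M N : Mat m) : Submodule ℂ (S.L2 Set.univ × S.L2 Set.univ) :=
  S.relation Set.univ (S.boundaryCondition M N)

end System

end DiscreteHamiltonian

end

noncomputable section

namespace DiscreteHamiltonian

/-! The core is a fact about holomorphic matrices: `det D(z)` vanishes at `z₀` to order exactly `dim
ker D(z₀)` as soon as there is no Jordan chain of length two, that is, as soon as `D(z₀) v = 0` and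
`D'(z₀) v = D(z₀) w` force `v = 0` (`analyticOrderAt_det_eq_finrank_ker`). It is applied to `D(λ) =
M Θ_λ(-∞) - N Θ_λ(+∞)`, called `bvpMatrix`. The kernel of `D(λ)` is the space of initial values of
eigenfunctions (`eigenspace_TD_eq`), and definiteness makes the map from initial values to classes
in `l²_W(ℤ)` injective.

That `D` exists and is entire comes from the limit circle hypothesis. The orthogonal complement of
the range of the minimal relation minus `λ` consists of classes of square summable solutions for
`λ̄`, so defect index `2m` at `±i` makes every solution for `±i` square summable
(`sol_mem_preL2_of_defectIndex`). Variation of constants with a Gronwall inequality carries this to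
every `λ` (`summable_dens_sol`). The same estimate, taken relative to `λ = 0`, shows that `Θ_λ(n)`
converges locally uniformly in `λ` at both ends, so the limits are entire and the derivatives
converge too.

Jordan chains are excluded by self-adjointness (`eq_zero_of_jordan_chain`). The rank condition and
`M J M^* = N J N^*` say that `a'^* J a = b'^* J b` for any two pairs with `M a = N b` and `M a' = N
b'` (`boundary_form_eq`). The Lagrange identity equates the difference of the brackets of a solution
`y` with itself at `+∞` and `-∞` to `(λ - λ̄) ‖y‖²`, so a nonzero kernel vector forces `λ` to be
real. Differentiating the identity in `λ` at a real point gives `‖y‖²` as the boundary pairing of `Θ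
v` with `Θ' v`; for a Jordan chain this pairing vanishes, hence `y = 0`. -/

/-- A sequence with prescribed partial shift. -/
def unR {m : ℕ} (k : ℤ → Vec m) (n : ℤ) : Vec m :=
  Sum.elim (fun i => k (n - 1) (Sum.inl i)) (fun i => k n (Sum.inr i))

theorem R_unR {m : ℕ} (k : ℤ → Vec m) (n : ℤ) : R (unR k) n = k n := by
  ext i; cases i <;> simp [R, unR]

theorem R_sum_smul {m : ℕ} {ι : Type*} (s : Finset ι) (c : ι → ℂ) (y : ι → ℤ → Vec m) (n : ℤ) :
    R (∑ j ∈ s, c j • y j) n = ∑ j ∈ s, c j • R (y j) n := by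
  ext i; cases i <;> simp [R, Finset.sum_apply]

theorem bracket_eq {m : ℕ} (x y : ℤ → Vec m) (n : ℤ) :
    bracket x y n = ∑ i, (star (y n (Sum.inr i)) * x n (Sum.inl i)
      - star (y n (Sum.inl i)) * x n (Sum.inr i)) := by
  have hJ : J m = Matrix.fromBlocks 0 (-1) 1 0 := rfl
  rw [bracket, hJ, Matrix.fromBlocks_mulVec]
  simp [dotProduct, Fintype.sum_sum_type, Matrix.neg_mulVec, Finset.sum_sub_distrib]
  ring

theorem J_conjTranspose (m : ℕ) : (J m)ᴴ = -J m := by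
  have hJ : J m = Matrix.fromBlocks 0 (-1) 1 0 := rfl
  rw [hJ, Matrix.fromBlocks_conjTranspose]
  simp [Matrix.fromBlocks_neg]

theorem J_mul_J (m : ℕ) : J m * J m = -1 := Matrix.J_squared _ _

theorem J_mulVec_J_mulVec {m : ℕ} (x : Vec m) : J m *ᵥ (J m *ᵥ x) = -x := by
  rw [Matrix.mulVec_mulVec, J_mul_J, Matrix.neg_mulVec, Matrix.one_mulVec]

theorem norm_J_mulVec_le {m : ℕ} (x : Vec m) : ‖J m *ᵥ x‖ ≤ ‖x‖ := by
  have hJ : J m = Matrix.fromBlocks 0 (-1) 1 0 := rfl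
  rw [hJ, Matrix.fromBlocks_mulVec, pi_norm_le_iff_of_nonneg (norm_nonneg _)]
  rintro (i | i)
  · simpa [Matrix.neg_mulVec] using norm_le_pi_norm x (Sum.inr i)
  · simpa using norm_le_pi_norm x (Sum.inl i)

/-! ### Green's formula, uniqueness of solutions, the fundamental matrix. -/

namespace System

variable {m : ℕ} (S : System m)

theorem isHermitian_P (n : ℤ) : (S.P n).IsHermitian := by
  refine Matrix.IsHermitian.fromBlocks (S.isHermitian_C n).neg ?_ (S.isHermitian_B n)
  simp

theorem star_dotProduct_mulVec_of_isHermitian {Q : Mat m} (hQ : Q.IsHermitian) (x y : Vec m) :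
    star (Q *ᵥ x) ⬝ᵥ y = star x ⬝ᵥ (Q *ᵥ y) := by
  rw [Matrix.star_mulVec, hQ.eq, Matrix.dotProduct_mulVec]

/-- Green's formula at one node. -/
theorem bracket_succ_sub (y z : ℤ → Vec m) (n : ℤ) :
    bracket y z (n + 1) - bracket y z n
      = star (R z n) ⬝ᵥ S.l y n - star (S.l z n) ⬝ᵥ R y n := by
  have h : star (R z n) ⬝ᵥ S.l y n - star (S.l z n) ⬝ᵥ R y n
      = star (R z n) ⬝ᵥ (J m *ᵥ (y (n + 1) - y n))
        - star (J m *ᵥ (z (n + 1) - z n)) ⬝ᵥ R y n := by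
    rw [l, l, star_sub, dotProduct_sub, sub_dotProduct,
      star_dotProduct_mulVec_of_isHermitian (S.isHermitian_P n)]
    ring
  have hJ : J m = Matrix.fromBlocks 0 (-1) 1 0 := rfl
  rw [h, bracket_eq, bracket_eq, hJ, Matrix.fromBlocks_mulVec, Matrix.fromBlocks_mulVec]
  simp only [dotProduct, Fintype.sum_sum_type, Matrix.neg_mulVec, Matrix.one_mulVec,
    Matrix.zero_mulVec, zero_add, add_zero, Pi.star_apply, Sum.elim_inl, Sum.elim_inr, R,
    Pi.neg_apply, Function.comp_apply, Pi.sub_apply, star_neg, star_sub]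
  rw [← Finset.sum_add_distrib, ← Finset.sum_add_distrib, ← Finset.sum_sub_distrib,
    ← Finset.sum_sub_distrib]
  refine Finset.sum_congr rfl fun i _ => ?_
  ring

theorem isSolution_iff {lam : ℂ} {y : ℤ → Vec m} :
    S.IsSolution lam y ↔ ∀ n, S.l y n = lam • (S.W n *ᵥ R y n) := by
  refine forall_congr' fun n => ?_
  rw [l, Matrix.add_mulVec, Matrix.smul_mulVec, sub_eq_iff_eq_add']

theorem bracket_succ_sub_of_isSolution {lam mu : ℂ} {y z : ℤ → Vec m}
    (hy : S.IsSolution lam y) (hz : S.IsSolution mu z) (n : ℤ) :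
    bracket y z (n + 1) - bracket y z n = (lam - star mu) * S.dens z y n := by
  rw [S.bracket_succ_sub, S.isSolution_iff.1 hy, S.isSolution_iff.1 hz, star_smul,
    smul_dotProduct, dotProduct_smul, star_dotProduct_mulVec_of_isHermitian (S.isHermitian_W n),
    dens, smul_eq_mul, smul_eq_mul]
  ring

theorem IsSolution.add {lam : ℂ} {y z : ℤ → Vec m} (hy : S.IsSolution lam y)
    (hz : S.IsSolution lam z) : S.IsSolution lam (y + z) := by
  intro n
  rw [R_add, Matrix.mulVec_add, ← hy n, ← hz n, ← Matrix.mulVec_add]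
  congr 1
  simp only [Pi.add_apply]; abel

theorem IsSolution.smul {lam : ℂ} {y : ℤ → Vec m} (c : ℂ) (hy : S.IsSolution lam y) :
    S.IsSolution lam (c • y) := by
  intro n
  rw [R_smul, Matrix.mulVec_smul, ← hy n, ← Matrix.mulVec_smul]
  congr 1
  simp [smul_sub]

theorem isUnit_det {S : System m} (h : S.CondB1) (n : ℤ) : IsUnit (1 - S.A n).det :=
  (Matrix.isUnit_iff_isUnit_det _).1 (h n)

theorem isUnit_det_conjTranspose {S : System m} (h : S.CondB1) (n : ℤ) :
    IsUnit ((1 - S.A n)ᴴ).det := by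
  rw [Matrix.det_conjTranspose]; exact (isUnit_det h n).star

theorem sum_ext {x y : Vec m} (h1 : x ∘ Sum.inl = y ∘ Sum.inl) (h2 : x ∘ Sum.inr = y ∘ Sum.inr) :
    x = y := by
  ext i
  cases i with
  | inl i => exact congrFun h1 i
  | inr i => exact congrFun h2 i

/-- Forwards the step inverts `I - A(n)`, backwards it inverts `(I - A(n))^*`, so zero propagates in
both directions. -/
theorem eq_zero_succ_iff (h : S.CondB1) {lam : ℂ} {y : ℤ → Vec m}
    (hy : S.IsSolution lam y) (n : ℤ) : y (n + 1) = 0 ↔ y n = 0 := by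
  obtain ⟨h1, h2⟩ := (S.step_iff lam n y).1 (hy n)
  have z : ∀ (f : Fin m → Fin m ⊕ Fin m), (0 : Vec m) ∘ f = 0 := fun f => rfl
  have inj : ∀ {Q : Matrix (Fin m) (Fin m) ℂ}, IsUnit Q.det → ∀ x, Q *ᵥ x = 0 → x = 0 := by
    intro Q hQ x hx
    rw [← Matrix.one_mulVec x, ← Matrix.nonsing_inv_mul _ hQ, ← Matrix.mulVec_mulVec, hx,
      Matrix.mulVec_zero]
  constructor
  · intro h0
    rw [h0, z, z, Matrix.mulVec_zero] at h2
    have hv := inj (isUnit_det_conjTranspose h n) (y n ∘ Sum.inr) (by simpa using h2.symm)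
    rw [h0, z, hv, Matrix.mulVec_zero, Matrix.mulVec_zero, add_zero] at h1
    exact sum_ext h1.symm hv
  · intro h0
    rw [h0, z, z, Matrix.mulVec_zero, add_zero] at h1
    have hu := inj (isUnit_det h n) _ h1
    rw [h0, hu, z, Matrix.mulVec_zero, Matrix.mulVec_zero, add_zero] at h2
    exact sum_ext hu h2

theorem eq_zero_of_apply_eq_zero (h : S.CondB1) {lam : ℂ} {y : ℤ → Vec m}
    (hy : S.IsSolution lam y) (h0 : y 0 = 0) : y = 0 := by
  funext n
  induction n using Int.induction_on with
  | zero => exact h0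
  | succ i ih => exact (S.eq_zero_succ_iff h hy _).2 ih
  | pred i ih =>
    refine (S.eq_zero_succ_iff h hy _).1 ?_
    rw [sub_add_cancel]; exact ih

theorem eq_sol (h : S.CondB1) {lam : ℂ} {y : ℤ → Vec m} (hy : S.IsSolution lam y) :
    y = S.sol lam (y 0) := by
  have h1 := S.eq_zero_of_apply_eq_zero h
    (hy.add S (IsSolution.smul S (-1) (S.sol_isSolution h lam (y 0))))
    (by simp [sol_zero])
  rw [neg_one_smul, ← sub_eq_add_neg, sub_eq_zero] at h1
  exact h1

theorem sol_add (h : S.CondB1) (lam : ℂ) (x y : Vec m) :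
    S.sol lam (x + y) = S.sol lam x + S.sol lam y := by
  have := S.eq_sol h ((S.sol_isSolution h lam x).add S (S.sol_isSolution h lam y))
  rw [this]; rfl

theorem sol_smul (h : S.CondB1) (lam c : ℂ) (x : Vec m) :
    S.sol lam (c • x) = c • S.sol lam x := by
  have := S.eq_sol h ((S.sol_isSolution h lam x).smul S c)
  rw [this]; rfl

/-- The solution with given initial value, as a linear map. -/
def solLin (h : S.CondB1) (lam : ℂ) : Vec m →ₗ[ℂ] (ℤ → Vec m) where
  toFun := S.sol lam
  map_add' := S.sol_add h lam
  map_smul' := S.sol_smul h lam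

theorem sol_eq_sum (h : S.CondB1) (lam : ℂ) (x : Vec m) :
    S.sol lam x = ∑ j, x j • S.theta lam j := by
  have : S.solLin h lam x = ∑ j, x j • S.solLin h lam (Pi.single j 1) := by
    conv_lhs => rw [pi_eq_sum_univ' x, map_sum]
    refine Finset.sum_congr rfl fun j _ => ?_
    rw [map_smul]
  exact this

/-- The fundamental matrix with columns `theta lam j`. -/
def Y (lam : ℂ) (n : ℤ) : Mat m := Matrix.of fun i j => S.theta lam j n i

theorem sol_apply (h : S.CondB1) (lam : ℂ) (x : Vec m) (n : ℤ) :
    S.sol lam x n = S.Y lam n *ᵥ x := by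
  rw [S.sol_eq_sum h]
  ext i
  simp [Y, Matrix.mulVec, dotProduct, Finset.sum_apply, mul_comm]

theorem Theta_eq (lam : ℂ) (n : ℤ) : S.Theta lam n = (S.Y 0 n)ᴴ * J m * S.Y lam n := by
  ext i j
  rw [Theta, Matrix.of_apply, bracket, Matrix.mul_assoc, Matrix.mul_apply]
  rfl

theorem bracket_sol (h : S.CondB1) (lam mu : ℂ) (x w : Vec m) (n : ℤ) :
    bracket (S.sol lam x) (S.sol mu w) n
      = star w ⬝ᵥ (((S.Y mu n)ᴴ * J m * S.Y lam n) *ᵥ x) := by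
  rw [bracket, S.sol_apply h, S.sol_apply h, Matrix.star_mulVec, ← Matrix.dotProduct_mulVec,
    Matrix.mulVec_mulVec, Matrix.mulVec_mulVec, Matrix.mul_assoc]

theorem bracket_sol_theta (h : S.CondB1) (lam : ℂ) (x : Vec m) (n : ℤ) :
    (fun i => bracket (S.sol lam x) (S.theta 0 i) n) = S.Theta lam n *ᵥ x := by
  ext i
  rw [theta, S.bracket_sol h, S.Theta_eq]
  rw [← Pi.single_star, star_one, single_one_dotProduct]

/-- The Wronskian identity. -/
theorem Y_conj_mul_J_mul_Y (h : S.CondB1) (lam : ℂ) (n : ℤ) :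
    (S.Y (star lam) n)ᴴ * J m * S.Y lam n = J m := by
  have key : ∀ n, (S.Y (star lam) n)ᴴ * J m * S.Y lam n
      = Matrix.of fun i j => bracket (S.theta lam j) (S.theta (star lam) i) n := by
    intro n
    ext i j
    rw [Matrix.of_apply, bracket, Matrix.mul_assoc, Matrix.mul_apply]
    rfl
  have step : ∀ n, (S.Y (star lam) (n + 1))ᴴ * J m * S.Y lam (n + 1)
      = (S.Y (star lam) n)ᴴ * J m * S.Y lam n := by
    intro n
    rw [key, key]
    ext i j
    have := S.bracket_succ_sub_of_isSolution (S.sol_isSolution h lam (Pi.single j 1))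
      (S.sol_isSolution h (star lam) (Pi.single i 1)) n
    rw [star_star, sub_self, zero_mul, sub_eq_zero] at this
    exact this
  have h0 : ∀ mu, S.Y mu 0 = 1 := by
    intro mu
    ext i j
    simp [Y, theta, sol_zero, Pi.single_apply, Matrix.one_apply]
  induction n using Int.induction_on with
  | zero => simp [h0]
  | succ i ih => rw [step, ih]
  | pred i ih =>
    have := step (-(i : ℤ) - 1)
    rw [sub_add_cancel, ih] at this
    exact this.symm

theorem Y_mul_neg_J (h : S.CondB1) (lam : ℂ) (n : ℤ) :
    S.Y lam n * (-J m * (S.Y (star lam) n)ᴴ * J m) = 1 := by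
  rw [mul_eq_one_comm, Matrix.mul_assoc, Matrix.mul_assoc, ← Matrix.mul_assoc _ (J m),
    S.Y_conj_mul_J_mul_Y h, neg_mul, J_mul_J, neg_neg]

/-- Variation of constants. -/
theorem Y_eq_Y_mul (h : S.CondB1) (lam mu : ℂ) (n : ℤ) :
    S.Y lam n = S.Y mu n * (-J m * ((S.Y (star mu) n)ᴴ * J m * S.Y lam n)) := by
  conv_lhs => rw [← Matrix.one_mul (S.Y lam n), ← S.Y_mul_neg_J h mu n]
  simp only [Matrix.mul_assoc]

/-- Up to the factor `-J`, `Θ_λ(n) x` is the coordinate vector of the solution in the basis `θ_j(n)`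
for parameter 0, and the Wronskian identity says that these coordinates preserve the form `J`. Hence
brackets of solutions have limits wherever `Θ` does. -/
theorem bracket_sol_eq_Theta (h : S.CondB1) (lam mu : ℂ) (x w : Vec m) (n : ℤ) :
    bracket (S.sol lam x) (S.sol mu w) n
      = star (S.Theta mu n *ᵥ w) ⬝ᵥ (J m *ᵥ (S.Theta lam n *ᵥ x)) := by
  have hY : ∀ nu, S.Y nu n = S.Y 0 n * (-J m * S.Theta nu n) := by
    intro nu
    have := S.Y_eq_Y_mul h nu 0 n
    rw [star_zero, ← S.Theta_eq] at this
    exact this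
  have h0 := S.Y_conj_mul_J_mul_Y h 0 n
  rw [star_zero] at h0
  have key : (S.Y mu n)ᴴ * J m * S.Y lam n = (S.Theta mu n)ᴴ * (J m * S.Theta lam n) := by
    rw [hY lam, hY mu, Matrix.conjTranspose_mul, Matrix.conjTranspose_mul,
      Matrix.conjTranspose_neg, J_conjTranspose, neg_neg]
    calc (S.Theta mu n)ᴴ * J m * (S.Y 0 n)ᴴ * J m * (S.Y 0 n * (-J m * S.Theta lam n))
        = (S.Theta mu n)ᴴ * J m * ((S.Y 0 n)ᴴ * J m * S.Y 0 n) * (-J m * S.Theta lam n) := by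
          simp only [Matrix.mul_assoc]
      _ = (S.Theta mu n)ᴴ * (J m * S.Theta lam n) := by
          rw [h0, Matrix.mul_assoc, Matrix.mul_assoc, ← Matrix.mul_assoc (J m) (-J m), mul_neg,
            J_mul_J, neg_neg, Matrix.one_mul]
  rw [S.bracket_sol h, key, Matrix.star_mulVec, ← Matrix.dotProduct_mulVec, Matrix.mulVec_mulVec,
    Matrix.mulVec_mulVec, Matrix.mul_assoc]

/-! ### Square summable sequences and their classes. -/

/-- An element of `PreL2` from a square summable sequence. -/
def mkPreL2 (I : Set ℤ) (y : ℤ → Vec m) (hy : y ∈ S.preL2 I) : S.PreL2 I :=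
  (⟨y, hy⟩ : S.preL2 I)

theorem seq_mkPreL2 (I : Set ℤ) (y : ℤ → Vec m) (hy : y ∈ S.preL2 I) :
    S.seq I (S.mkPreL2 I y hy) = y := rfl

theorem seq_mem_preL2 (I : Set ℤ) (y : S.PreL2 I) : S.seq I y ∈ S.preL2 I :=
  (show S.preL2 I from y).2

theorem mem_preL2_iff {I : Set ℤ} {y : ℤ → Vec m} :
    y ∈ S.preL2 I ↔ Summable fun n : I => (S.dens y y n).re := Iff.rfl

theorem mem_preL2_of_support {I : Set ℤ} {y : ℤ → Vec m} (s : Finset ℤ)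
    (hs : ∀ n ∉ s, R y n = 0) : y ∈ S.preL2 I := by
  refine S.mem_preL2_iff.2 ?_
  refine (summable_of_ne_finset_zero (s := s) (f := fun n => (S.dens y y n).re) ?_).comp_injective
    Subtype.val_injective
  intro n hn
  simp [dens, hs n hn]

theorem cls_eq_zero_iff {I : Set ℤ} {y : S.PreL2 I} :
    S.cls I y = 0 ↔ ∀ n ∈ I, S.W n *ᵥ R (S.seq I y) n = 0 := by
  refine ⟨fun h n hn => S.W_mulVec_R_of_cls_eq_zero h hn, fun h => ?_⟩
  rw [← inner_self_eq_zero (𝕜 := ℂ), S.inner_eq]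
  have : (fun n : I => S.dens (S.seq I y) (S.seq I y) n) = fun _ => 0 := by
    ext n
    rw [dens, h n n.2, dotProduct_zero]
  rw [this, tsum_zero]

theorem dens_eq_zero_iff {y : ℤ → Vec m} {n : ℤ} :
    (S.dens y y n).re = 0 ↔ S.W n *ᵥ R y n = 0 := by
  rw [← (S.posSemidef_W n).dotProduct_mulVec_zero_iff]
  constructor
  · intro h
    have := S.ofReal_dens_self y n
    rw [h, Complex.ofReal_zero] at this
    exact this.symm
  · intro h
    rw [dens, h, Complex.zero_re]

/-! ### Orthogonal complements of ranges and solutions for the conjugate parameter. -/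

/-- The initial value problem with zero initial value and a source supported in a window. -/
theorem exists_inhomogeneous (h : S.CondB1) (lam : ℂ) (k : ℤ → Vec m) (a b : ℤ)
    (hab : a ≤ b) (hk : ∀ n, ¬ (a ≤ n ∧ n ≤ b) → k n = 0)
    (horth : ∀ j, ∑ n ∈ Finset.Icc a b,
      star (R (S.theta (star lam) j) n) ⬝ᵥ (S.W n *ᵥ k n) = 0) :
    ∃ f : ℤ → Vec m, (∀ n, (n ≤ a ∨ b + 1 ≤ n) → f n = 0) ∧
      ∀ n, S.l f n = lam • (S.W n *ᵥ R f n) + S.W n *ᵥ k n := by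
  -- One step of the forced recursion: the homogeneous step `stepUp`, plus a particular increment
  -- `q` that starts from 0 and absorbs the source `p`.
  have hstep : ∀ (n : ℤ) (x p : Vec m), ∃ x' : Vec m, J m *ᵥ (x' - x)
      = (S.P n + lam • S.W n) *ᵥ Sum.elim (x' ∘ Sum.inl) (x ∘ Sum.inr) + p := by
    intro n x p
    have h1 : J m *ᵥ (S.stepUp lam n x - x) = (S.P n + lam • S.W n) *ᵥ
        Sum.elim (S.stepUp lam n x ∘ Sum.inl) (x ∘ Sum.inr) := by
      have := (S.step_iff lam n (fun j => if j = n then x else S.stepUp lam n x)).2 (by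
        simp only [add_eq_left, one_ne_zero, if_false, if_true]
        simp only [stepUp, Sum.elim_comp_inl, Sum.elim_comp_inr, Matrix.mulVec_mulVec,
          Matrix.mul_nonsing_inv _ (isUnit_det h n), Matrix.one_mulVec, and_self])
      simp only [add_eq_left, one_ne_zero, if_false, if_true] at this
      rw [this]
      congr 1
      ext i; cases i <;> simp [R]
    set u : Fin m → ℂ := (1 - S.A n)⁻¹ *ᵥ (p ∘ Sum.inr) with hu
    have hu' : u = S.A n *ᵥ u + p ∘ Sum.inr := by
      have : (1 - S.A n) *ᵥ u = p ∘ Sum.inr := by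
        rw [hu, Matrix.mulVec_mulVec, Matrix.mul_nonsing_inv _ (isUnit_det h n),
          Matrix.one_mulVec]
      rw [← this, Matrix.sub_mulVec, Matrix.one_mulVec]; abel
    set q : Vec m := Sum.elim u ((S.C n - lam • S.W₁ n) *ᵥ u - p ∘ Sum.inl) with hq
    have h2 : J m *ᵥ q = (S.P n + lam • S.W n) *ᵥ Sum.elim u 0 + p := by
      have hP : S.P n + lam • S.W n = Matrix.fromBlocks (-S.C n + lam • S.W₁ n) (S.A n)ᴴ (S.A n)
          (S.B n + lam • S.W₂ n) := by
        simp [P, W, Matrix.fromBlocks_smul, Matrix.fromBlocks_add]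
      have hJ : J m = Matrix.fromBlocks 0 (-1) 1 0 := rfl
      rw [hP, hJ, Matrix.fromBlocks_mulVec, Matrix.fromBlocks_mulVec, hq]
      refine sum_ext ?_ ?_
      · ext i
        simp [Matrix.add_mulVec, Matrix.sub_mulVec, Matrix.neg_mulVec]
        ring
      · ext i
        have := congrFun hu' i
        simpa using this
    refine ⟨S.stepUp lam n x + q, ?_⟩
    rw [add_sub_right_comm, Matrix.mulVec_add, h1, h2, ← add_assoc, ← Matrix.mulVec_add]
    congr 2
    ext i; cases i <;> simp [q]
  choose st hst using hstep
  let g : ℕ → Vec m := fun j => Nat.rec 0 (fun i z => st (a + i) z (S.W (a + i) *ᵥ k (a + i))) j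
  let F : ℤ → Vec m := fun n => g (n - a).toNat
  have hF0 : ∀ n, n ≤ a → F n = 0 := by
    intro n hn
    simp only [F]
    rw [Int.toNat_of_nonpos (by omega)]
    rfl
  have hl_iff : ∀ (f : ℤ → Vec m) n, (S.l f n = lam • (S.W n *ᵥ R f n) + S.W n *ᵥ k n) ↔
      J m *ᵥ (f (n + 1) - f n) = (S.P n + lam • S.W n) *ᵥ R f n + S.W n *ᵥ k n := by
    intro f n
    rw [l, Matrix.add_mulVec, Matrix.smul_mulVec, sub_eq_iff_eq_add', add_assoc]
  have hF : ∀ n, a ≤ n → S.l F n = lam • (S.W n *ᵥ R F n) + S.W n *ᵥ k n := by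
    intro n hn
    rw [hl_iff]
    obtain ⟨i, rfl⟩ : ∃ i : ℕ, n = a + i := ⟨(n - a).toNat, by omega⟩
    have e1 : F (a + i + 1) = g (i + 1) := by
      simp only [F]; rw [show (a + (i : ℤ) + 1 - a).toNat = i + 1 by omega]
    have e2 : F (a + i) = g i := by
      simp only [F]; rw [show (a + (i : ℤ) - a).toNat = i by omega]
    have := hst (a + i) (g i) (S.W (a + i) *ᵥ k (a + i))
    rw [e1, e2]
    have e3 : R F (a + i) = Sum.elim (g (i + 1) ∘ Sum.inl) (g i ∘ Sum.inr) := by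
      ext j; cases j <;> simp [R, e1, e2]
    rw [e3]
    exact this
  -- The bracket of `F` with each solution for `star lam` starts at 0 and gains exactly the terms of
  -- `horth`, so it vanishes at `b + 1`; invertibility of the fundamental matrix then kills `F (b +
  -- 1)`.
  have hFb : F (b + 1) = 0 := by
    have hbr : ∀ j, bracket F (S.theta (star lam) j) (b + 1) = 0 := by
      intro j
      have hz := S.sol_isSolution h (star lam) (Pi.single j 1)
      have hd : ∀ n ∈ Finset.Icc a b, bracket F (S.theta (star lam) j) (n + 1)
          - bracket F (S.theta (star lam) j) n
          = star (R (S.theta (star lam) j) n) ⬝ᵥ (S.W n *ᵥ k n) := by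
        intro n hn
        rw [Finset.mem_Icc] at hn
        rw [S.bracket_succ_sub, hF n hn.1, theta, S.isSolution_iff.1 hz, star_smul, star_star,
          smul_dotProduct, star_dotProduct_mulVec_of_isHermitian (S.isHermitian_W n),
          dotProduct_add, dotProduct_smul]
        ring
      have hsum := horth j
      rw [← Finset.sum_congr rfl hd] at hsum
      have htel : ∀ i : ℕ, ∑ n ∈ Finset.Icc a (a + i), (bracket F (S.theta (star lam) j) (n + 1)
          - bracket F (S.theta (star lam) j) n)
          = bracket F (S.theta (star lam) j) (a + i + 1) - bracket F (S.theta (star lam) j) a := by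
        intro i
        induction i with
        | zero => simp
        | succ i ih =>
          have : Finset.Icc a (a + (i + 1 : ℕ)) = insert (a + (i + 1 : ℕ)) (Finset.Icc a (a + i)) := by
            ext n; simp only [Finset.mem_insert, Finset.mem_Icc]; push_cast; omega
          rw [this, Finset.sum_insert (by simp), ih]
          push_cast
          rw [add_assoc a i 1]
          ring
      have hb := htel (b - a).toNat
      have e : a + ((b - a).toNat : ℤ) = b := by omega
      rw [e, hsum] at hb
      have ha : bracket F (S.theta (star lam) j) a = 0 := by
        rw [bracket, hF0 a le_rfl]; simp
      rw [ha, sub_zero] at hb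
      exact hb.symm
    have hm : (S.Y (star lam) (b + 1))ᴴ *ᵥ (J m *ᵥ F (b + 1)) = 0 := by
      ext j
      exact hbr j
    have := S.Y_mul_neg_J h lam (b + 1)
    rw [← Matrix.one_mulVec (F (b + 1)), ← this, ← Matrix.mulVec_mulVec, ← Matrix.mulVec_mulVec,
      ← Matrix.mulVec_mulVec, hm, Matrix.mulVec_zero, Matrix.mulVec_zero]
  -- Cutting off after `b` does not disturb the equation at the node `b`, because the value at `b +
  -- 1` was already 0.
  let f : ℤ → Vec m := fun n => if n ≤ b then F n else 0
  have hfF : ∀ n, n ≤ b + 1 → f n = F n := by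
    intro n hn
    by_cases h' : n ≤ b
    · simp [f, h']
    · have : n = b + 1 := by omega
      simp [f, this, hFb]
  have hf0 : ∀ n, (n ≤ a ∨ b + 1 ≤ n) → f n = 0 := by
    intro n hn
    rcases hn with hn | hn
    · rw [hfF n (by omega), hF0 n hn]
    · simp [f, show ¬ n ≤ b by omega]
  refine ⟨f, hf0, fun n => ?_⟩
  have hRz : f (n + 1) = 0 → f n = 0 → R f n = 0 := by
    intro h1 h2
    ext i; cases i <;> simp [R, h1, h2]
  by_cases hn : a ≤ n ∧ n ≤ b
  · have hR : R f n = R F n := by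
      ext i; cases i <;> simp [R, hfF (n + 1) (by omega), hfF n (by omega)]
    have := hF n hn.1
    rw [l] at this ⊢
    rw [hR, hfF (n + 1) (by omega), hfF n (by omega), this]
  · have h1 : f (n + 1) = 0 := hf0 _ (by omega)
    have h2 : f n = 0 := hf0 _ (by omega)
    rw [l, hRz h1 h2, h1, h2, hk n hn]
    simp

/-- On a window inside `I`, an element orthogonal to the range of `T₀ - lam` agrees with a
solution for the conjugate parameter. -/
theorem exists_sol_on_window (h : S.CondB1) (lam : ℂ) {I : Set ℤ} (y : S.PreL2 I)
    (hy : S.cls I y ∈ (rangeSub (S.preMinimal I) lam)ᗮ) (a b : ℤ) (hab : a ≤ b)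
    (hI : Set.Icc a b ⊆ I) :
    ∃ x : Vec m, ∀ n ∈ Set.Icc a b,
      S.W n *ᵥ R (S.seq I y) n = S.W n *ᵥ R (S.sol (star lam) x) n := by
  let fn : (ℤ → Vec m) → (ℤ → Vec m) →ₗ[ℂ] ℂ := fun z =>
    { toFun := fun k => ∑ n ∈ Finset.Icc a b, star (R z n) ⬝ᵥ (S.W n *ᵥ k n)
      map_add' := by
        intro k k'
        simp [Matrix.mulVec_add, Finset.sum_add_distrib]
      map_smul' := by
        intro c k
        simp [Matrix.mulVec_smul, Finset.mul_sum] }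
  -- A source orthogonal to all `θ_j` on the window is of the form `g - lam f` with `f` supported
  -- inside it, hence is orthogonal to `y`. By duality the functional of `y` is then a combination
  -- of those of the `θ_j`.
  have hker : ⨅ j, LinearMap.ker (fn (S.theta (star lam) j)) ≤ LinearMap.ker (fn (S.seq I y)) := by
    intro k hk
    rw [Submodule.mem_iInf] at hk
    let k' : ℤ → Vec m := fun n => if a ≤ n ∧ n ≤ b then k n else 0
    have hkk' : ∀ z, fn z k' = fn z k := by
      intro z
      change ∑ n ∈ Finset.Icc a b, star (R z n) ⬝ᵥ (S.W n *ᵥ k' n)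
        = ∑ n ∈ Finset.Icc a b, star (R z n) ⬝ᵥ (S.W n *ᵥ k n)
      refine Finset.sum_congr rfl fun n hn => ?_
      rw [Finset.mem_Icc] at hn
      simp [k', hn]
    have hk0 : ∀ n, ¬ (a ≤ n ∧ n ≤ b) → k' n = 0 := fun n hn => by simp [k', hn]
    obtain ⟨f, hf0, hf⟩ := S.exists_inhomogeneous h lam k' a b hab hk0 (fun j => by
      have : k ∈ LinearMap.ker (fn (S.theta (star lam) j)) := hk j
      rw [LinearMap.mem_ker, ← hkk'] at this
      exact this)
    have hkmem : unR k' ∈ S.preL2 I := S.mem_preL2_of_support (Finset.Icc a b) (fun n hn => by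
      rw [R_unR]; exact hk0 n (by simpa using hn))
    have hfmem : f ∈ S.preL2 I := S.mem_preL2_of_support (Finset.Icc a b) (fun n hn => by
      rw [Finset.mem_Icc] at hn
      ext i; cases i <;> simp [R, hf0 (n + 1) (by omega), hf0 n (by omega)])
    set K := S.mkPreL2 I _ hkmem
    set Fm := S.mkPreL2 I _ hfmem
    have hpre : (S.cls I Fm, S.cls I (K + lam • Fm)) ∈ S.preMinimal I := by
      refine ⟨Fm, rfl, ⟨⟨a, b, hab, hf0⟩, fun n hn => hf0 n ?_⟩, fun g hg n hn => ?_⟩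
      · by_contra hcon
        have h1 : n - 1 ∈ I := hI ⟨by omega, by omega⟩
        have h2 : n ∈ I := hI ⟨by omega, by omega⟩
        tauto
      · have h0 : S.cls I (g - (K + lam • Fm)) = 0 := by rw [map_sub, hg, sub_self]
        have h1 := S.cls_eq_zero_iff.1 h0 n hn
        rw [map_sub, R_sub, Matrix.mulVec_sub, sub_eq_zero] at h1
        rw [h1, map_add, map_smul, R_add, R_smul, Matrix.mulVec_add, Matrix.mulVec_smul]
        simp only [K, Fm, seq_mkPreL2]
        rw [R_unR, hf n, add_comm]
    have hrange : S.cls I K ∈ rangeSub (S.preMinimal I) lam := by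
      refine ⟨_, hpre, ?_⟩
      simp
    have h0 := Submodule.inner_left_of_mem_orthogonal hrange hy
    rw [S.inner_eq] at h0
    rw [LinearMap.mem_ker, ← hkk']
    rw [← h0]
    have hts := tsum_subtype I (fun n => S.dens (S.seq I y) (S.seq I K) n)
    rw [hts, tsum_eq_sum (s := Finset.Icc a b)]
    · change ∑ n ∈ Finset.Icc a b, star (R (S.seq I y) n) ⬝ᵥ (S.W n *ᵥ k' n) = _
      refine Finset.sum_congr rfl fun n hn => ?_
      rw [Finset.mem_Icc] at hn
      rw [Set.indicator_of_mem (hI ⟨hn.1, hn.2⟩), dens]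
      simp only [K, seq_mkPreL2, R_unR]
    · intro n hn
      refine Set.indicator_apply_eq_zero.2 fun _ => ?_
      rw [dens]
      simp only [K, seq_mkPreL2, R_unR]
      rw [hk0 n (by simpa using hn)]
      simp
  have hspan := mem_span_of_iInf_ker_le_ker hker
  rw [Submodule.mem_span_range_iff_exists_fun] at hspan
  obtain ⟨c, hc⟩ := hspan
  -- The functionals `fn z` are conjugate linear in `z`, so the coefficients of the solution are
  -- conjugated.
  refine ⟨star c, fun n hn => ?_⟩
  set d : Vec m := R (S.seq I y) n - R (S.sol (star lam) (star c)) n with hd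
  have hsum : ∀ k : ℤ → Vec m, fn (S.seq I y) k = fn (S.sol (star lam) (star c)) k := by
    intro k
    rw [← hc, S.sol_eq_sum h]
    simp only [LinearMap.sum_apply, LinearMap.smul_apply, fn, LinearMap.coe_mk, AddHom.coe_mk,
      R_sum_smul, Finset.smul_sum]
    rw [Finset.sum_comm]
    refine Finset.sum_congr rfl fun n _ => ?_
    simp only [star_sum, sum_dotProduct, star_smul, smul_dotProduct, Pi.star_apply, star_star]
  have hn' : n ∈ Finset.Icc a b := by simpa using hn
  have hone : ∀ z : ℤ → Vec m, fn z (Pi.single n d) = star (R z n) ⬝ᵥ (S.W n *ᵥ d) := by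
    intro z
    simp only [fn, LinearMap.coe_mk, AddHom.coe_mk]
    rw [Finset.sum_eq_single_of_mem n hn']
    · simp
    · intro k _ hk
      simp [Pi.single_eq_of_ne hk]
  -- Testing against the difference `d` itself, placed at `n`, gives `d^* W d = 0` and hence `W d =
  -- 0`.
  have h1 := hsum (Pi.single n d)
  rw [hone, hone, ← sub_eq_zero, ← sub_dotProduct, ← star_sub, ← hd,
    (S.posSemidef_W n).dotProduct_mulVec_zero_iff, hd, Matrix.mulVec_sub, sub_eq_zero] at h1
  exact h1

/-! ### Definiteness and the defect indices. -/

/-- Definiteness of the system on the window `[p, q]`. -/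
def IsDefiniteOn (p q : ℤ) : Prop :=
  ∀ (lam : ℂ) (y : ℤ → Vec m), S.IsSolution lam y → y ≠ 0 →
    0 < ∑ n ∈ Finset.Icc p q, (S.dens y y n).re

theorem eq_zero_of_definite (h : S.CondB1) {p q : ℤ} (hdef : S.IsDefiniteOn p q) (lam : ℂ)
    (x : Vec m) (hx : ∀ n ∈ Set.Icc p q, S.W n *ᵥ R (S.sol lam x) n = 0) : x = 0 := by
  by_contra hne
  have hy : S.sol lam x ≠ 0 := by
    intro h0
    exact hne (by rw [← S.sol_zero lam x, h0]; rfl)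
  have := hdef lam _ (S.sol_isSolution h lam x) hy
  rw [Finset.sum_eq_zero] at this
  · exact lt_irrefl _ this
  · intro n hn
    rw [Finset.mem_Icc] at hn
    exact S.dens_eq_zero_iff.2 (hx n hn)

/-- Every window containing `[p, q]` supplies a solution, and definiteness on `[p, q]` forces all of
these to have the same initial value; so a single solution works on all of `I`. -/
theorem exists_sol_of_mem_orthogonal (h : S.CondB1) (lam : ℂ) {I : Set ℤ} (hI : I.OrdConnected)
    {p q : ℤ} (hpq : p ≤ q) (hpqI : Set.Icc p q ⊆ I) (hdef : S.IsDefiniteOn p q) (y : S.PreL2 I)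
    (hy : S.cls I y ∈ (rangeSub (S.preMinimal I) lam)ᗮ) :
    ∃ x : Vec m, ∀ n ∈ I, S.W n *ᵥ R (S.seq I y) n = S.W n *ᵥ R (S.sol (star lam) x) n := by
  obtain ⟨x, hx⟩ := S.exists_sol_on_window h lam y hy p q hpq hpqI
  refine ⟨x, fun n hn => ?_⟩
  have hp : p ∈ I := hpqI ⟨le_rfl, hpq⟩
  have hq : q ∈ I := hpqI ⟨hpq, le_rfl⟩
  have hsub : Set.Icc (min p n) (max q n) ⊆ I := by
    refine hI.out ?_ ?_
    · rcases min_choice p n with h' | h' <;> rw [h'] <;> assumption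
    · rcases max_choice q n with h' | h' <;> rw [h'] <;> assumption
  obtain ⟨x', hx'⟩ := S.exists_sol_on_window h lam y hy (min p n) (max q n) (by omega) hsub
  have hxx : x - x' = 0 := by
    refine S.eq_zero_of_definite h hdef (star lam) _ fun k hk => ?_
    have h1 := hx k hk
    have h2 := hx' k ⟨(min_le_left _ _).trans hk.1, hk.2.trans (le_max_left _ _)⟩
    have h3 := (S.solLin h (star lam)).map_sub x x'
    change S.sol (star lam) (x - x') = S.sol (star lam) x - S.sol (star lam) x' at h3
    rw [h3, R_sub, Matrix.mulVec_sub, ← h1, ← h2, sub_self]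
  rw [sub_eq_zero.1 hxx]
  exact hx' n ⟨min_le_right _ _, le_max_right _ _⟩

/-- The defect space lies in the image of the space `V` of initial values of square summable
solutions for `star lam`. Hence `2m ≤ dim V`, and `V` is everything. -/
theorem sol_mem_preL2_of_defectIndex (h : S.CondB1) (lam : ℂ) {I : Set ℤ} (hI : I.OrdConnected)
    {p q : ℤ} (hpq : p ≤ q) (hpqI : Set.Icc p q ⊆ I) (hdef : S.IsDefiniteOn p q)
    (hindex : defectIndex (S.minimal I) lam = ((2 * m : ℕ) : Cardinal)) (x : Vec m) :
    S.sol (star lam) x ∈ S.preL2 I := by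
  let V : Submodule ℂ (Vec m) := (S.preL2 I).comap (S.solLin h (star lam))
  let L : V →ₗ[ℂ] S.L2 I := (S.cls I).comp
    (show V →ₗ[ℂ] S.preL2 I from (S.solLin h (star lam)).restrict (fun _ hx => hx))
  have hle : (rangeSub (S.minimal I) lam)ᗮ ≤ LinearMap.range L := by
    intro g hg
    obtain ⟨y, rfl⟩ := S.cls_surjective I g
    have hg' : S.cls I y ∈ (rangeSub (S.preMinimal I) lam)ᗮ := by
      refine Submodule.orthogonal_le ?_ hg
      exact Submodule.map_mono (Submodule.le_topologicalClosure _)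
    obtain ⟨x, hx⟩ := S.exists_sol_of_mem_orthogonal h lam hI hpq hpqI hdef y hg'
    have hmem : S.sol (star lam) x ∈ S.preL2 I := by
      have hd : ∀ n : I, (S.dens (S.sol (star lam) x) (S.sol (star lam) x) n).re
          = (S.dens (S.seq I y) (S.seq I y) n).re := by
        intro n
        congr 1
        rw [dens, dens, ← hx n n.2, ← star_dotProduct_mulVec_of_isHermitian (S.isHermitian_W n),
          ← hx n n.2, star_dotProduct_mulVec_of_isHermitian (S.isHermitian_W n)]
      exact (S.mem_preL2_iff.1 (S.seq_mem_preL2 I y)).congr fun n => (hd n).symm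
    refine ⟨⟨x, hmem⟩, ?_⟩
    have : S.cls I (S.mkPreL2 I _ hmem - y) = 0 := by
      rw [S.cls_eq_zero_iff]
      intro n hn
      rw [map_sub, R_sub, Matrix.mulVec_sub, hx n hn, seq_mkPreL2, sub_self]
    rw [map_sub, sub_eq_zero] at this
    exact this
  have h1 : ((2 * m : ℕ) : Cardinal) ≤ Module.finrank ℂ V := by
    rw [Module.finrank_eq_rank, ← hindex]
    have h2 := (Submodule.rank_mono hle)
    have h3 := lift_rank_range_le L
    rw [Cardinal.lift_id, Cardinal.lift_id] at h3
    exact h2.trans h3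
  have h2 : V = ⊤ := by
    refine Submodule.eq_top_of_finrank_eq (le_antisymm (Submodule.finrank_le _) ?_)
    have : Module.finrank ℂ (Vec m) = 2 * m := by
      rw [Module.finrank_fintype_fun_eq_card]; simp; ring
    rw [this]
    exact_mod_cast h1
  have : x ∈ V := h2 ▸ Submodule.mem_top
  exact this

end System

/-! ### Gronwall estimates. -/

/-- Expand the nonnegative form at `c x - y`, where `c` is the phase of `x^* Q y`. The additive form
of Cauchy–Schwarz avoids square roots of densities, so that summable densities bound summable
sequences directly. -/
theorem norm_star_dotProduct_mulVec_le {ι : Type*} [Fintype ι] {Q : Matrix ι ι ℂ}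
    (hQ : Q.PosSemidef) (x y : ι → ℂ) :
    ‖star x ⬝ᵥ (Q *ᵥ y)‖ ≤ (star x ⬝ᵥ (Q *ᵥ x)).re + (star y ⬝ᵥ (Q *ᵥ y)).re := by
  have hnn : ∀ z, 0 ≤ (star z ⬝ᵥ (Q *ᵥ z)).re := fun z =>
    (Complex.le_def.1 (hQ.dotProduct_mulVec_nonneg z)).1
  set b := star x ⬝ᵥ (Q *ᵥ y) with hb
  by_cases hb0 : b = 0
  · rw [hb0, norm_zero]
    exact add_nonneg (hnn x) (hnn y)
  have hnb : (‖b‖ : ℂ) ≠ 0 := by simpa using hb0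
  have hsymm : star y ⬝ᵥ (Q *ᵥ x) = star b := by
    rw [hb, ← Matrix.star_dotProduct_star, star_star, dotProduct_comm, Matrix.star_mulVec,
      hQ.isHermitian.eq, dotProduct_comm, Matrix.dotProduct_mulVec]
  have hbb : star b * b = ‖b‖ ^ 2 := Complex.conj_mul' b
  have h := hnn ((b / ‖b‖) • x - y)
  have hexp : star ((b / ‖b‖) • x - y) ⬝ᵥ (Q *ᵥ ((b / ‖b‖) • x - y))
      = star x ⬝ᵥ (Q *ᵥ x) + star y ⬝ᵥ (Q *ᵥ y) - 2 * ‖b‖ := by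
    have hstar : star (b / (‖b‖ : ℂ)) = star b / ‖b‖ := by
      rw [star_div₀]
      congr 1
      exact Complex.conj_ofReal _
    rw [Matrix.mulVec_sub, Matrix.mulVec_smul, star_sub, star_smul, hstar]
    simp only [sub_dotProduct, dotProduct_sub, smul_dotProduct, dotProduct_smul, smul_eq_mul]
    rw [← hb, hsymm]
    field_simp
    linear_combination (star x ⬝ᵥ Q *ᵥ x - 2 * (‖b‖ : ℂ)) * hbb
  rw [hexp] at h
  simp only [Complex.sub_re, Complex.add_re, Complex.mul_re, Complex.re_ofNat, Complex.ofReal_re,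
    Complex.im_ofNat, Complex.ofReal_im] at h
  have := norm_nonneg b
  linarith

/-- A discrete implicit Gronwall inequality, with constants independent of the sequence. -/
theorem exists_gronwall {E : Type*} [SeminormedAddCommGroup E] {a : ℕ → ℝ} (ha0 : ∀ n, 0 ≤ a n)
    (ha : Summable a) :
    ∃ (k : ℕ) (C : ℝ), 0 ≤ C ∧ ∀ X : ℕ → E,
      (∀ n, ‖X (n + 1) - X n‖ ≤ a n * (‖X (n + 1)‖ + ‖X n‖)) → ∀ n, k ≤ n → ‖X n‖ ≤ C * ‖X k‖ := by
  -- Below `1/2` the implicit recursion can be solved for the new term: `1 + a ≤ (1 - a) (1 + 4 a)`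
  -- for `0 ≤ a ≤ 1/2`, which is the source of the constant 4.
  obtain ⟨k, hk⟩ := eventually_atTop.1
    (ha.tendsto_atTop_zero.eventually (gt_mem_nhds (show (0 : ℝ) < 1 / 2 by norm_num)))
  refine ⟨k, Real.exp (4 * ∑' n, a (k + n)), (Real.exp_pos _).le, fun X hX n hn => ?_⟩
  have hs : Summable fun n => a (k + n) := by
    simpa only [add_comm] using (summable_nat_add_iff k).2 ha
  have key : ∀ j, ‖X (k + j)‖ ≤ Real.exp (4 * ∑ i ∈ Finset.range j, a (k + i)) * ‖X k‖ := by
    intro j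
    induction j with
    | zero => simp
    | succ j ih =>
      have h1 := hX (k + j)
      have h2 : ‖X (k + j + 1)‖ ≤ ‖X (k + j)‖ + ‖X (k + j + 1) - X (k + j)‖ := by
        have := norm_add_le (X (k + j)) (X (k + j + 1) - X (k + j))
        rwa [add_sub_cancel] at this
      have h3 := hk (k + j) (by omega)
      have h4 := ha0 (k + j)
      have h5 : ‖X (k + j + 1)‖ ≤ (1 + 4 * a (k + j)) * ‖X (k + j)‖ := by
        have h6 := norm_nonneg (X (k + j))
        have h7 := norm_nonneg (X (k + j + 1))
        have h8 : (1 - a (k + j)) * ‖X (k + j + 1)‖ ≤ (1 + a (k + j)) * ‖X (k + j)‖ := by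
          linarith
        have h9 : (1 + a (k + j)) * ‖X (k + j)‖
            ≤ (1 - a (k + j)) * ((1 + 4 * a (k + j)) * ‖X (k + j)‖) := by
          rw [← mul_assoc]
          refine mul_le_mul_of_nonneg_right ?_ h6
          nlinarith
        exact le_of_mul_le_mul_left (h8.trans h9) (by linarith)
      rw [Finset.sum_range_succ, mul_add, Real.exp_add, ← add_assoc]
      refine h5.trans ?_
      have h10 : 1 + 4 * a (k + j) ≤ Real.exp (4 * a (k + j)) := by
        have := Real.add_one_le_exp (4 * a (k + j)); linarith
      calc (1 + 4 * a (k + j)) * ‖X (k + j)‖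
          ≤ Real.exp (4 * a (k + j)) * (Real.exp (4 * ∑ i ∈ Finset.range j, a (k + i)) * ‖X k‖) :=
            mul_le_mul h10 ih (norm_nonneg _) (Real.exp_pos _).le
        _ = _ := by ring
  obtain ⟨j, rfl⟩ := Nat.exists_eq_add_of_le hn
  refine (key j).trans (mul_le_mul_of_nonneg_right (Real.exp_le_exp.2 ?_) (norm_nonneg _))
  refine mul_le_mul_of_nonneg_left ?_ (by norm_num)
  exact hs.sum_le_tsum _ (fun i _ => ha0 _)

theorem exists_bound_of_gronwall {E : Type*} [SeminormedAddCommGroup E] {a : ℕ → ℝ}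
    (ha0 : ∀ n, 0 ≤ a n) (ha : Summable a) {X : ℕ → E}
    (hX : ∀ n, ‖X (n + 1) - X n‖ ≤ a n * (‖X (n + 1)‖ + ‖X n‖)) : ∃ K, ∀ n, ‖X n‖ ≤ K := by
  obtain ⟨k, C, hC, h⟩ := exists_gronwall (E := E) ha0 ha
  refine ⟨C * ‖X k‖ + ∑ j ∈ Finset.range k, ‖X j‖, fun n => ?_⟩
  have h1 : 0 ≤ C * ‖X k‖ := mul_nonneg hC (norm_nonneg _)
  have h2 : 0 ≤ ∑ j ∈ Finset.range k, ‖X j‖ := Finset.sum_nonneg fun _ _ => norm_nonneg _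
  rcases le_or_gt k n with hn | hn
  · linarith [h X hX n hn]
  · have := Finset.single_le_sum (f := fun j => ‖X j‖) (fun _ _ => norm_nonneg _)
      (Finset.mem_range.2 hn)
    linarith

/-- On a ball of radius `r`, Gronwall with weights `r * a n` bounds all late `F n` by one constant,
so the increments are dominated by a summable series and the Weierstrass test applies. -/
theorem exists_tendstoLocallyUniformly_of_gronwall {E : Type*} [NormedAddCommGroup E]
    [CompleteSpace E] {a : ℕ → ℝ} (ha0 : ∀ n, 0 ≤ a n) (ha : Summable a) {F : ℕ → ℂ → E}
    (hF : ∀ k, Continuous (F k))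
    (h : ∀ z n, ‖F (n + 1) z - F n z‖ ≤ ‖z‖ * a n * (‖F (n + 1) z‖ + ‖F n z‖)) :
    ∃ L : ℂ → E, TendstoLocallyUniformly F L atTop := by
  have hball : ∀ r : ℝ, ∃ L : ℂ → E, TendstoUniformlyOn F L atTop (Metric.ball 0 r) := by
    intro r
    obtain ⟨k, C, hC, hk⟩ := exists_gronwall (E := E) (a := fun n => |r| * a n)
      (fun n => mul_nonneg (abs_nonneg _) (ha0 n)) (ha.mul_left _)
    obtain ⟨K, hK⟩ := (isCompact_closedBall (0 : ℂ) r).exists_bound_of_continuousOn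
      (hF k).continuousOn
    have hinc : ∀ z ∈ Metric.ball (0 : ℂ) r, ∀ n,
        ‖F (n + 1) z - F n z‖ ≤ |r| * a n * (‖F (n + 1) z‖ + ‖F n z‖) := by
      intro z hz n
      refine (h z n).trans ?_
      have hz' : ‖z‖ ≤ |r| := (mem_ball_zero_iff.1 hz).le.trans (le_abs_self r)
      have := ha0 n
      gcongr
    have hb : ∀ z ∈ Metric.ball (0 : ℂ) r, ∀ n, k ≤ n → ‖F n z‖ ≤ C * K := by
      intro z hz n hn
      refine (hk (fun n => F n z) (hinc z hz) n hn).trans ?_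
      exact mul_le_mul_of_nonneg_left (hK z (Metric.ball_subset_closedBall hz)) hC
    have hs : Summable fun n => |r| * a (n + k) * (2 * (C * K)) :=
      (((summable_nat_add_iff k).2 ha).mul_left _).mul_right _
    have hu := tendstoUniformlyOn_tsum_nat (f := fun n z => F (n + k + 1) z - F (n + k) z) hs
      (s := Metric.ball (0 : ℂ) r) (fun n z hz => by
        refine (hinc z hz (n + k)).trans ?_
        have h1 := hb z hz (n + k + 1) (by omega)
        have h2 := hb z hz (n + k) (by omega)
        refine mul_le_mul_of_nonneg_left (by linarith) (mul_nonneg (abs_nonneg _) (ha0 _)))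
    refine ⟨fun z => F k z + ∑' n, (F (n + k + 1) z - F (n + k) z), ?_⟩
    rw [Metric.tendstoUniformlyOn_iff] at hu ⊢
    intro ε hε
    have := (tendsto_sub_atTop_nat k).eventually (hu ε hε)
    filter_upwards [this, eventually_ge_atTop k] with n hn hkn z hz
    have hd := hn z hz
    have htel : ∑ j ∈ Finset.range (n - k), (F (j + k + 1) z - F (j + k) z) = F n z - F k z := by
      have := Finset.sum_range_sub (fun j => F (j + k) z) (n - k)
      simp only [zero_add, Nat.sub_add_cancel hkn] at this
      rw [← this]
      refine Finset.sum_congr rfl fun j _ => ?_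
      rw [add_right_comm]
    rw [htel] at hd
    rw [dist_eq_norm] at hd ⊢
    convert hd using 2
    abel
  choose L hL using hball
  -- Gluing: the radius `‖z‖ + 1` gives a ball containing `z`, and uniqueness of pointwise limits
  -- makes the choices on different balls agree.
  refine ⟨fun z => L (‖z‖ + 1) z, fun u hu x => ⟨Metric.ball 0 (‖x‖ + 1), ?_, ?_⟩⟩
  · exact Metric.isOpen_ball.mem_nhds (by simp)
  · have hcongr : ∀ z ∈ Metric.ball (0 : ℂ) (‖x‖ + 1), L (‖x‖ + 1) z = L (‖z‖ + 1) z := by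
      intro z hz
      exact tendsto_nhds_unique ((hL (‖x‖ + 1)).tendsto_at hz)
        ((hL (‖z‖ + 1)).tendsto_at (by simp))
    filter_upwards [hL (‖x‖ + 1) u hu] with n hn z hz
    rw [← hcongr z hz]
    exact hn z hz

/-! ### Square summability of solutions for every spectral parameter. -/

namespace System

variable {m : ℕ} (S : System m)

theorem dens_eq_add (y z : ℤ → Vec m) (n : ℤ) :
    S.dens y z n = star (R y n ∘ Sum.inl) ⬝ᵥ (S.W₁ n *ᵥ (R z n ∘ Sum.inl))
      + star (R y n ∘ Sum.inr) ⬝ᵥ (S.W₂ n *ᵥ (R z n ∘ Sum.inr)) := by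
  simp [dens, W, Matrix.fromBlocks_mulVec, dotProduct, Fintype.sum_sum_type]

/-- The brackets of the solution `sol lam x` with the fundamental solutions for `mu`. -/
def bvec (mu lam : ℂ) (x : Vec m) (n : ℤ) : Vec m :=
  fun i => bracket (S.sol lam x) (S.theta mu i) n

theorem bvec_eq (h : S.CondB1) (mu lam : ℂ) (x : Vec m) (n : ℤ) :
    S.bvec mu lam x n = ((S.Y mu n)ᴴ * J m * S.Y lam n) *ᵥ x := by
  ext i
  rw [bvec, theta, S.bracket_sol h, ← Pi.single_star, star_one, single_one_dotProduct]

theorem sol_eq_bvec (h : S.CondB1) (mu lam : ℂ) (x : Vec m) (n : ℤ) :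
    S.sol lam x n = S.Y mu n *ᵥ (-(J m *ᵥ S.bvec (star mu) lam x n)) := by
  rw [S.sol_apply h, S.Y_eq_Y_mul h lam mu, S.bvec_eq h, ← Matrix.mulVec_mulVec,
    ← Matrix.mulVec_mulVec, Matrix.neg_mulVec]

/-- The sum of the densities of the fundamental solutions. -/
def totalDens (lam : ℂ) (n : ℤ) : ℝ := ∑ j, (S.dens (S.theta lam j) (S.theta lam j) n).re

theorem totalDens_nonneg (lam : ℂ) (n : ℤ) : 0 ≤ S.totalDens lam n :=
  Finset.sum_nonneg fun _ _ => S.dens_self_nonneg _ _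

/-- Expand the solution in the basis for `mu`. The partial shift mixes two nodes, so the `u` half
carries the coefficients at `n + 1` and the `v` half those at `n`; since `W` is block diagonal, the
halves are estimated separately. The factor `2m` counts the basis solutions. -/
theorem norm_dens_sol_le (h : S.CondB1) (z : ℤ → Vec m) (mu lam : ℂ) (x : Vec m) (n : ℤ) :
    ‖S.dens z (S.sol lam x) n‖
      ≤ ((2 * m : ℕ) * (S.dens z z n).re + S.totalDens mu n)
        * (‖S.bvec (star mu) lam x (n + 1)‖ + ‖S.bvec (star mu) lam x n‖) := by
  set g : ℤ → Vec m := fun k => -(J m *ᵥ S.bvec (star mu) lam x k) with hg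
  have hgn : ∀ k j, ‖g k j‖ ≤ ‖S.bvec (star mu) lam x k‖ := by
    intro k j
    refine (norm_le_pi_norm (g k) j).trans ?_
    rw [hg]
    simp only [norm_neg]
    exact norm_J_mulVec_le _
  have hl : R (S.sol lam x) n ∘ Sum.inl
      = ∑ j, g (n + 1) j • (R (S.theta mu j) n ∘ Sum.inl) := by
    ext i
    simp only [R, Function.comp_apply, Sum.elim_inl, Finset.sum_apply, Pi.smul_apply, smul_eq_mul]
    rw [S.sol_eq_bvec h mu]
    simp only [Matrix.mulVec, dotProduct, Y, Matrix.of_apply, hg, mul_comm]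
  have hr : R (S.sol lam x) n ∘ Sum.inr
      = ∑ j, g n j • (R (S.theta mu j) n ∘ Sum.inr) := by
    ext i
    simp only [R, Function.comp_apply, Sum.elim_inr, Finset.sum_apply, Pi.smul_apply, smul_eq_mul]
    rw [S.sol_eq_bvec h mu]
    simp only [Matrix.mulVec, dotProduct, Y, Matrix.of_apply, hg, mul_comm]
  have nn1 : ∀ y : ℤ → Vec m,
      0 ≤ (star (R y n ∘ Sum.inl) ⬝ᵥ (S.W₁ n *ᵥ (R y n ∘ Sum.inl))).re := fun y =>
    (Complex.le_def.1 ((S.posSemidef_W₁ n).dotProduct_mulVec_nonneg _)).1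
  have nn2 : ∀ y : ℤ → Vec m,
      0 ≤ (star (R y n ∘ Sum.inr) ⬝ᵥ (S.W₂ n *ᵥ (R y n ∘ Sum.inr))).re := fun y =>
    (Complex.le_def.1 ((S.posSemidef_W₂ n).dotProduct_mulVec_nonneg _)).1
  have h1 : ∀ j, ‖star (R z n ∘ Sum.inl) ⬝ᵥ (S.W₁ n *ᵥ (R (S.theta mu j) n ∘ Sum.inl))‖
      ≤ (S.dens z z n).re + (S.dens (S.theta mu j) (S.theta mu j) n).re := by
    intro j
    refine (norm_star_dotProduct_mulVec_le (S.posSemidef_W₁ n) _ _).trans ?_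
    rw [dens_eq_add, dens_eq_add, Complex.add_re, Complex.add_re]
    linarith [nn2 z, nn2 (S.theta mu j)]
  have h2 : ∀ j, ‖star (R z n ∘ Sum.inr) ⬝ᵥ (S.W₂ n *ᵥ (R (S.theta mu j) n ∘ Sum.inr))‖
      ≤ (S.dens z z n).re + (S.dens (S.theta mu j) (S.theta mu j) n).re := by
    intro j
    refine (norm_star_dotProduct_mulVec_le (S.posSemidef_W₂ n) _ _).trans ?_
    rw [dens_eq_add, dens_eq_add, Complex.add_re, Complex.add_re]
    linarith [nn1 z, nn1 (S.theta mu j)]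
  have hw : ∑ j, ((S.dens z z n).re + (S.dens (S.theta mu j) (S.theta mu j) n).re)
      = (2 * m : ℕ) * (S.dens z z n).re + S.totalDens mu n := by
    rw [Finset.sum_add_distrib, totalDens]
    simp [two_mul]
  have hlin : ∀ (Q : Matrix (Fin m) (Fin m) ℂ) (v : Fin m → ℂ) (c : Vec m)
      (w : Fin m ⊕ Fin m → Fin m → ℂ), v ⬝ᵥ (Q *ᵥ ∑ j, c j • w j) = ∑ j, c j * (v ⬝ᵥ (Q *ᵥ w j)) := by
    intro Q v c w
    rw [Matrix.mulVec_sum, dotProduct_sum]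
    simp [Matrix.mulVec_smul]
  rw [dens_eq_add, hl, hr, hlin, hlin, ← hw, mul_add, Finset.sum_mul, Finset.sum_mul]
  refine (norm_add_le _ _).trans (add_le_add ?_ ?_)
  · refine (norm_sum_le _ _).trans (Finset.sum_le_sum fun j _ => ?_)
    rw [norm_mul, mul_comm]
    exact mul_le_mul (h1 j) (hgn _ _) (norm_nonneg _) ((norm_nonneg _).trans (h1 j))
  · refine (norm_sum_le _ _).trans (Finset.sum_le_sum fun j _ => ?_)
    rw [norm_mul, mul_comm]
    exact mul_le_mul (h2 j) (hgn _ _) (norm_nonneg _) ((norm_nonneg _).trans (h2 j))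

/-- A weight controlling the increments of `bvec`. -/
def gWeight (mu : ℂ) (n : ℤ) : ℝ :=
  (2 * m : ℕ) * S.totalDens (star mu) n + S.totalDens mu n

theorem gWeight_nonneg (mu : ℂ) (n : ℤ) : 0 ≤ S.gWeight mu n :=
  add_nonneg (mul_nonneg (Nat.cast_nonneg _) (S.totalDens_nonneg _ _)) (S.totalDens_nonneg _ _)

/-- Each component increases by `lam - mu` times a density against a solution for `star mu`, to
which `norm_dens_sol_le` applies. The bound involves the new value as well as the old one, hence the
implicit form of the Gronwall inequality. -/
theorem norm_bvec_succ_sub_le (h : S.CondB1) (mu lam : ℂ) (x : Vec m) (n : ℤ) :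
    ‖S.bvec (star mu) lam x (n + 1) - S.bvec (star mu) lam x n‖
      ≤ ‖lam - mu‖ * S.gWeight mu n
        * (‖S.bvec (star mu) lam x (n + 1)‖ + ‖S.bvec (star mu) lam x n‖) := by
  have hnn : 0 ≤ ‖S.bvec (star mu) lam x (n + 1)‖ + ‖S.bvec (star mu) lam x n‖ := by positivity
  rw [pi_norm_le_iff_of_nonneg
    (mul_nonneg (mul_nonneg (norm_nonneg _) (S.gWeight_nonneg _ _)) hnn)]
  intro i
  have h1 := S.bracket_succ_sub_of_isSolution (S.sol_isSolution h lam x)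
    (S.sol_isSolution h (star mu) (Pi.single i 1)) n
  rw [star_star] at h1
  change ‖bracket (S.sol lam x) (S.sol (star mu) (Pi.single i 1)) (n + 1)
    - bracket (S.sol lam x) (S.sol (star mu) (Pi.single i 1)) n‖ ≤ _
  rw [h1, norm_mul, mul_assoc]
  refine mul_le_mul_of_nonneg_left ?_ (norm_nonneg _)
  refine (S.norm_dens_sol_le h _ mu lam x n).trans (mul_le_mul_of_nonneg_right ?_ hnn)
  refine add_le_add (mul_le_mul_of_nonneg_left ?_ (Nat.cast_nonneg _)) le_rfl
  exact Finset.single_le_sum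
    (f := fun j => (S.dens (S.theta (star mu) j) (S.theta (star mu) j) n).re)
    (fun _ _ => S.dens_self_nonneg _ _) (Finset.mem_univ i)

theorem neg_natCast_succ_add_one (n : ℕ) : -((n : ℤ) + 1) + 1 = -(n : ℤ) := by ring

theorem injective_neg_natCast_succ : Function.Injective fun n : ℕ => -((n : ℤ) + 1) := by
  intro a b hab
  simp only at hab
  omega

/-- If all solutions for `mu` and its conjugate are square summable, then so are all solutions. -/
theorem summable_dens_sol (h : S.CondB1) {mu : ℂ} (h1 : Summable (S.totalDens mu))
    (h2 : Summable (S.totalDens (star mu))) (lam : ℂ) (x : Vec m) :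
    Summable fun n => (S.dens (S.sol lam x) (S.sol lam x) n).re := by
  have hG : Summable (S.gWeight mu) := (h2.mul_left _).add h1
  have hG' : Summable fun n => ‖lam - mu‖ * S.gWeight mu n := hG.mul_left _
  have hnn : ∀ n, 0 ≤ ‖lam - mu‖ * S.gWeight mu n := fun n =>
    mul_nonneg (norm_nonneg _) (S.gWeight_nonneg _ _)
  have hstep := S.norm_bvec_succ_sub_le h mu lam x
  obtain ⟨K₁, hK₁⟩ := exists_bound_of_gronwall (X := fun k : ℕ => S.bvec (star mu) lam x k)
    (a := fun k : ℕ => ‖lam - mu‖ * S.gWeight mu k) (fun k => hnn _)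
    (hG'.comp_injective Nat.cast_injective) (fun k => by
      have := hstep k
      push_cast
      exact this)
  -- Towards `-∞` the step from `-k` to `-(k + 1)` is governed by the equation at the node `-(k +
  -- 1)`.
  obtain ⟨K₂, hK₂⟩ := exists_bound_of_gronwall (X := fun k : ℕ => S.bvec (star mu) lam x (-k))
    (a := fun k : ℕ => ‖lam - mu‖ * S.gWeight mu (-((k : ℤ) + 1))) (fun k => hnn _)
    (hG'.comp_injective injective_neg_natCast_succ) (fun k => by
      have := hstep (-((k : ℤ) + 1))
      rw [neg_natCast_succ_add_one] at this
      push_cast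
      rw [norm_sub_rev, add_comm ‖S.bvec (star mu) lam x (-((k : ℤ) + 1))‖]
      exact this)
  set K := max K₁ K₂ with hKdef
  have hK : ∀ n, ‖S.bvec (star mu) lam x n‖ ≤ K := by
    intro n
    obtain ⟨k, rfl | rfl⟩ := n.eq_nat_or_neg
    · exact (hK₁ k).trans (le_max_left _ _)
    · exact (hK₂ k).trans (le_max_right _ _)
  have hK0 : 0 ≤ K := (norm_nonneg _).trans (hK 0)
  set K' : ℝ := 2 * K * (2 * m : ℕ) + 1 with hK'
  have hK'0 : 0 < K' := by positivity
  refine Summable.of_nonneg_of_le (fun n => S.dens_self_nonneg _ _) (fun n => ?_)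
    (h1.mul_left (4 * K' * (2 * K)))
  set b := (S.dens (S.sol lam x) (S.sol lam x) n).re with hb
  have hb0 : 0 ≤ b := S.dens_self_nonneg _ _
  -- Scaling one argument by `c` multiplies the left side by `c` but its density on the right by `c
  -- ^ 2`. With `K' * c = 1 / 2` the right-hand multiple of `b` is absorbed; the `+ 1` in `K'` only
  -- ensures positivity.
  set c : ℝ := 1 / (2 * K') with hc
  have hc0 : 0 < c := by positivity
  have hmain := S.norm_dens_sol_le h ((c : ℂ) • S.sol lam x) mu lam x n
  have hw := S.totalDens_nonneg mu n
  have hl : ‖S.dens ((c : ℂ) • S.sol lam x) (S.sol lam x) n‖ = c * b := by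
    rw [dens_smul_left, ← S.ofReal_dens_self, Complex.conj_ofReal, ← Complex.ofReal_mul,
      Complex.norm_real, Real.norm_eq_abs, abs_of_nonneg (mul_nonneg hc0.le hb0)]
  have hr : (S.dens ((c : ℂ) • S.sol lam x) ((c : ℂ) • S.sol lam x) n).re = c ^ 2 * b := by
    rw [dens_smul_left, dens_smul_right, ← S.ofReal_dens_self, Complex.conj_ofReal,
      ← Complex.ofReal_mul, ← Complex.ofReal_mul, Complex.ofReal_re]
    ring
  rw [hl, hr] at hmain
  have hmain2 : c * b ≤ ((2 * m : ℕ) * (c ^ 2 * b) + S.totalDens mu n) * (2 * K) := by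
    refine hmain.trans (mul_le_mul_of_nonneg_left (by linarith [hK n, hK (n + 1)]) ?_)
    positivity
  have h3 : K' * c = 1 / 2 := by rw [hc]; field_simp
  have h4 : c * b ≤ (K' * c) * (c * b) + S.totalDens mu n * (2 * K) := by
    have : 0 ≤ c ^ 2 * b := by positivity
    rw [hK']
    linarith
  rw [h3] at h4
  have h5 : c * b ≤ 2 * (S.totalDens mu n * (2 * K)) := by linarith
  have h6 : b = 2 * K' * (c * b) := by
    rw [← mul_assoc, mul_assoc 2, h3]; ring
  rw [h6]
  calc 2 * K' * (c * b) ≤ 2 * K' * (2 * (S.totalDens mu n * (2 * K))) :=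
        mul_le_mul_of_nonneg_left h5 (by positivity)
    _ = _ := by ring

/-! ### Analytic dependence on the parameter and the limits of `Θ`. -/

theorem differentiable_stepUp (n : ℤ) {x : ℂ → Vec m} (hx : Differentiable ℂ x) :
    Differentiable ℂ fun lam => S.stepUp lam n (x lam) := by
  have hx' : ∀ i, Differentiable ℂ fun lam => x lam i := fun i => differentiable_pi.1 hx i
  have hu : ∀ i, Differentiable ℂ fun lam => S.stepUp lam n (x lam) (Sum.inl i) := by
    intro i
    simp only [stepUp, Sum.elim_inl, Matrix.mulVec, dotProduct, Pi.add_apply, Function.comp_apply,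
      Matrix.add_apply, Matrix.smul_apply, smul_eq_mul]
    fun_prop
  refine differentiable_pi.2 ?_
  rintro (i | i)
  · exact hu i
  · have : (fun lam => S.stepUp lam n (x lam) (Sum.inr i)) = fun lam =>
        ((1 - S.A n)ᴴ *ᵥ (x lam ∘ Sum.inr)) i
          + ∑ j, (S.C n i j - lam * S.W₁ n i j) * S.stepUp lam n (x lam) (Sum.inl j) := rfl
    rw [this]
    simp only [Matrix.mulVec, dotProduct, Function.comp_apply]
    fun_prop

theorem differentiable_stepDown (n : ℤ) {x : ℂ → Vec m} (hx : Differentiable ℂ x) :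
    Differentiable ℂ fun lam => S.stepDown lam n (x lam) := by
  have hx' : ∀ i, Differentiable ℂ fun lam => x lam i := fun i => differentiable_pi.1 hx i
  have hv : ∀ i, Differentiable ℂ fun lam => S.stepDown lam n (x lam) (Sum.inr i) := by
    intro i
    simp only [stepDown, Sum.elim_inr, Matrix.mulVec, dotProduct, Pi.sub_apply,
      Function.comp_apply, Matrix.sub_apply, Matrix.smul_apply, smul_eq_mul]
    fun_prop
  refine differentiable_pi.2 ?_
  rintro (i | i)
  · have : (fun lam => S.stepDown lam n (x lam) (Sum.inl i)) = fun lam =>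
        ((1 - S.A n) *ᵥ (x lam ∘ Sum.inl)) i
          - ∑ j, (S.B n i j + lam * S.W₂ n i j) * S.stepDown lam n (x lam) (Sum.inr j) := rfl
    rw [this]
    simp only [Matrix.mulVec, dotProduct, Function.comp_apply]
    fun_prop
  · exact hv i

theorem differentiable_sol (x : Vec m) (n : ℤ) : Differentiable ℂ fun lam => S.sol lam x n := by
  cases n with
  | ofNat k =>
    induction k with
    | zero => exact differentiable_const x
    | succ k ih => exact S.differentiable_stepUp _ ih
  | negSucc k =>
    induction k with
    | zero => exact S.differentiable_stepDown _ (differentiable_const x)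
    | succ k ih => exact S.differentiable_stepDown _ ih

theorem Theta_mulVec_eq_bvec (h : S.CondB1) (lam : ℂ) (x : Vec m) (n : ℤ) :
    S.Theta lam n *ᵥ x = S.bvec 0 lam x n := by
  rw [S.bvec_eq h, S.Theta_eq]

theorem differentiable_Theta_mulVec (h : S.CondB1) (x : Vec m) (n : ℤ) :
    Differentiable ℂ fun lam => S.Theta lam n *ᵥ x := by
  have hs : ∀ i, Differentiable ℂ fun lam => S.sol lam x n i :=
    fun i => differentiable_pi.1 (S.differentiable_sol x n) i
  refine differentiable_pi.2 fun i => ?_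
  simp only [S.Theta_mulVec_eq_bvec h, bvec, bracket_eq]
  fun_prop

theorem tendsto_of_forall_mulVec {α : Type*} {l : Filter α} {T : α → Mat m} {L : Vec m → Vec m}
    (h : ∀ x, Tendsto (fun k => T k *ᵥ x) l (𝓝 (L x))) :
    Tendsto T l (𝓝 (Matrix.of fun i j => L (Pi.single j 1) i)) := by
  refine tendsto_pi_nhds.2 fun i => tendsto_pi_nhds.2 fun j => ?_
  have := tendsto_pi_nhds.1 (h (Pi.single j 1)) i
  simpa using this

theorem tendsto_mulVec {α : Type*} {l : Filter α} {T : α → Mat m} {T' : Mat m}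
    (h : Tendsto T l (𝓝 T')) (x : Vec m) : Tendsto (fun k => T k *ᵥ x) l (𝓝 (T' *ᵥ x)) := by
  have : Continuous fun A : Mat m => A *ᵥ x := by fun_prop
  exact (this.tendsto T').comp h

theorem exists_tendsto_Theta_top (h : S.CondB1) (h0 : Summable (S.totalDens 0)) (x : Vec m) :
    ∃ L : ℂ → Vec m, TendstoLocallyUniformly (fun (k : ℕ) lam => S.Theta lam k *ᵥ x) L atTop := by
  have hG : Summable (S.gWeight 0) := by
    refine Summable.add (Summable.mul_left _ ?_) h0
    rwa [star_zero]
  refine exists_tendstoLocallyUniformly_of_gronwall (a := fun k : ℕ => S.gWeight 0 k)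
    (fun k => S.gWeight_nonneg _ _) (hG.comp_injective Nat.cast_injective)
    (fun k => (S.differentiable_Theta_mulVec h x k).continuous) (fun z k => ?_)
  have := S.norm_bvec_succ_sub_le h 0 z x k
  rw [star_zero, sub_zero] at this
  simp only [S.Theta_mulVec_eq_bvec h]
  push_cast
  exact this

theorem exists_tendsto_Theta_bot (h : S.CondB1) (h0 : Summable (S.totalDens 0)) (x : Vec m) :
    ∃ L : ℂ → Vec m,
      TendstoLocallyUniformly (fun (k : ℕ) lam => S.Theta lam (-k) *ᵥ x) L atTop := by
  have hG : Summable (S.gWeight 0) := by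
    refine Summable.add (Summable.mul_left _ ?_) h0
    rwa [star_zero]
  refine exists_tendstoLocallyUniformly_of_gronwall
    (a := fun k : ℕ => S.gWeight 0 (-((k : ℤ) + 1)))
    (fun k => S.gWeight_nonneg _ _) (hG.comp_injective injective_neg_natCast_succ)
    (fun k => (S.differentiable_Theta_mulVec h x _).continuous) (fun z k => ?_)
  have := S.norm_bvec_succ_sub_le h 0 z x (-((k : ℤ) + 1))
  rw [star_zero, sub_zero, neg_natCast_succ_add_one] at this
  simp only [S.Theta_mulVec_eq_bvec h]
  push_cast
  rw [norm_sub_rev, add_comm ‖S.bvec 0 z x (-((k : ℤ) + 1))‖]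
  exact this

theorem map_neg_natCast_atTop : map (fun k : ℕ => -(k : ℤ)) atTop = atBot := by
  have : (fun k : ℕ => -(k : ℤ)) = Neg.neg ∘ (Nat.cast : ℕ → ℤ) := rfl
  rw [this, ← Filter.map_map, Nat.map_cast_int_atTop, Filter.map_neg_atTop]

theorem tendsto_Theta_top (h : S.CondB1) (h0 : Summable (S.totalDens 0)) (lam : ℂ) :
    Tendsto (S.Theta lam) atTop (𝓝 (S.ThetaTop lam)) := by
  choose L hL using S.exists_tendsto_Theta_top h h0
  have h1 := tendsto_of_forall_mulVec (T := fun k : ℕ => S.Theta lam k) (L := fun x => L x lam)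
    fun x => (hL x).tendstoLocallyUniformlyOn.tendsto_at (Set.mem_univ lam)
  refine tendsto_nhds_limUnder ⟨Matrix.of fun i j => L (Pi.single j 1) lam i, ?_⟩
  rw [← Nat.map_cast_int_atTop]
  exact tendsto_map'_iff.2 h1

theorem tendsto_Theta_bot (h : S.CondB1) (h0 : Summable (S.totalDens 0)) (lam : ℂ) :
    Tendsto (S.Theta lam) atBot (𝓝 (S.ThetaBot lam)) := by
  choose L hL using S.exists_tendsto_Theta_bot h h0
  have h1 := tendsto_of_forall_mulVec (T := fun k : ℕ => S.Theta lam (-k))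
    (L := fun x => L x lam)
    fun x => (hL x).tendstoLocallyUniformlyOn.tendsto_at (Set.mem_univ lam)
  refine tendsto_nhds_limUnder ⟨Matrix.of fun i j => L (Pi.single j 1) lam i, ?_⟩
  rw [← map_neg_natCast_atTop]
  exact tendsto_map'_iff.2 h1

theorem tendsto_Theta_natCast (h : S.CondB1) (h0 : Summable (S.totalDens 0)) (lam : ℂ) (x : Vec m) :
    Tendsto (fun k : ℕ => S.Theta lam k *ᵥ x) atTop (𝓝 (S.ThetaTop lam *ᵥ x)) :=
  (tendsto_mulVec (S.tendsto_Theta_top h h0 lam) x).comp tendsto_natCast_atTop_atTop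

theorem tendsto_Theta_neg_natCast (h : S.CondB1) (h0 : Summable (S.totalDens 0)) (lam : ℂ)
    (x : Vec m) :
    Tendsto (fun k : ℕ => S.Theta lam (-k) *ᵥ x) atTop (𝓝 (S.ThetaBot lam *ᵥ x)) :=
  (tendsto_mulVec (S.tendsto_Theta_bot h h0 lam) x).comp map_neg_natCast_atTop.le

theorem tendstoLocallyUniformly_Theta_top (h : S.CondB1) (h0 : Summable (S.totalDens 0))
    (x : Vec m) : TendstoLocallyUniformly (fun (k : ℕ) lam => S.Theta lam k *ᵥ x)
      (fun lam => S.ThetaTop lam *ᵥ x) atTop := by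
  obtain ⟨L, hL⟩ := S.exists_tendsto_Theta_top h h0 x
  have : L = fun lam => S.ThetaTop lam *ᵥ x := by
    funext lam
    exact tendsto_nhds_unique (hL.tendstoLocallyUniformlyOn.tendsto_at (Set.mem_univ lam))
      (S.tendsto_Theta_natCast h h0 lam x)
  rwa [← this]

theorem tendstoLocallyUniformly_Theta_bot (h : S.CondB1) (h0 : Summable (S.totalDens 0))
    (x : Vec m) : TendstoLocallyUniformly (fun (k : ℕ) lam => S.Theta lam (-k) *ᵥ x)
      (fun lam => S.ThetaBot lam *ᵥ x) atTop := by
  obtain ⟨L, hL⟩ := S.exists_tendsto_Theta_bot h h0 x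
  have : L = fun lam => S.ThetaBot lam *ᵥ x := by
    funext lam
    exact tendsto_nhds_unique (hL.tendstoLocallyUniformlyOn.tendsto_at (Set.mem_univ lam))
      (S.tendsto_Theta_neg_natCast h h0 lam x)
  rwa [← this]

end System

/-! ### The order of vanishing of a determinant. -/

/-- In the splitting into `p` and `ker f` the map is `t` on the first summand and the identity on
the second. -/
theorem det_one_sub_add_smul_of_isProj {V : Type*} [AddCommGroup V] [Module ℂ V]
    [FiniteDimensional ℂ V] {p : Submodule ℂ V} {f : V →ₗ[ℂ] V} (hf : LinearMap.IsProj p f)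
    (t : ℂ) : LinearMap.det (1 - f + t • f) = t ^ Module.finrank ℂ p := by
  let e := Submodule.prodEquivOfIsCompl p (LinearMap.ker f) hf.isCompl
  have he : 1 - f + t • f = (e : (p × LinearMap.ker f) →ₗ[ℂ] V) ∘ₗ
      (LinearMap.prodMap (t • LinearMap.id) LinearMap.id) ∘ₗ
      (e.symm : V →ₗ[ℂ] (p × LinearMap.ker f)) := by
    rw [← LinearMap.comp_assoc, LinearEquiv.eq_comp_toLinearMap_symm]
    refine LinearMap.ext fun x => ?_
    obtain ⟨⟨a, ha⟩, ⟨b, hb⟩⟩ := x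
    have h1 : f a = a := hf.map_id a ha
    have h2 : f b = 0 := hb
    simp [e, h1, h2, add_comm]
  rw [he, LinearMap.det_conj, LinearMap.det_prodMap]
  simp

theorem exists_isProj {V : Type*} [AddCommGroup V] [Module ℂ V] (p : Submodule ℂ V) :
    ∃ f : V →ₗ[ℂ] V, LinearMap.IsProj p f := by
  obtain ⟨g, hg⟩ := p.subtype.exists_leftInverse_of_injective p.ker_subtype
  refine ⟨p.subtype ∘ₗ g, fun x => (g x).2, fun x hx => ?_⟩
  exact congrArg Subtype.val (LinearMap.congr_fun hg ⟨x, hx⟩)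

theorem matrix_eq_zero_of_mulVec {ι : Type*} [Fintype ι] [DecidableEq ι] {Q : Matrix ι ι ℂ}
    (h : ∀ v, Q *ᵥ v = 0) : Q = 0 :=
  Matrix.ext_of_mulVec_single fun i => by rw [h, Matrix.zero_mulVec]

/-- If the kernel of `D z₀` carries no Jordan chain of length two, then the order of vanishing
of `det D` at `z₀` is the dimension of the kernel. -/
theorem analyticOrderAt_det_eq_finrank_ker {ι : Type*} [Fintype ι] [DecidableEq ι]
    {D : ℂ → Matrix ι ι ℂ} (hD : ∀ i j, Differentiable ℂ fun z => D z i j) (z₀ : ℂ)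
    (hchain : ∀ v w : ι → ℂ, D z₀ *ᵥ v = 0 →
      (Matrix.of fun i j => deriv (fun z => D z i j) z₀) *ᵥ v = D z₀ *ᵥ w → v = 0) :
    analyticOrderAt (fun z => (D z).det) z₀
      = (Module.finrank ℂ (LinearMap.ker (Matrix.toLin' (D z₀))) : ℕ∞) := by
  obtain ⟨f, hf⟩ := exists_isProj (LinearMap.ker (Matrix.toLin' (D z₀)))
  let Q : Matrix ι ι ℂ := LinearMap.toMatrix' f
  have hQ : ∀ v, Q *ᵥ v = f v := fun v => LinearMap.toMatrix'_mulVec f v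
  -- The difference quotient of `D` at `z₀`: holomorphic across `z₀`, with value `D'(z₀)` there.
  let E : ℂ → Matrix ι ι ℂ := fun z => Matrix.of fun i j => dslope (fun z => D z i j) z₀ z
  have hE0 : E z₀ = Matrix.of fun i j => deriv (fun z => D z i j) z₀ := by
    ext i j; simp [E, dslope_same]
  have hDE : ∀ z, D z = D z₀ + (z - z₀) • E z := by
    intro z
    ext i j
    have := sub_smul_dslope (fun z => D z i j) z₀ z
    simp only [E, Matrix.add_apply, Matrix.smul_apply, Matrix.of_apply]
    rw [this]; ring
  have hDQ : D z₀ * Q = 0 := by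
    refine matrix_eq_zero_of_mulVec fun v => ?_
    rw [← Matrix.mulVec_mulVec, hQ]
    exact hf.map_mem v
  have hQQ : Q * Q = Q := by
    refine sub_eq_zero.1 (matrix_eq_zero_of_mulVec fun v => ?_)
    rw [Matrix.sub_mulVec, ← Matrix.mulVec_mulVec, hQ, hQ, hf.map_id _ (hf.map_mem v), sub_self]
  -- Since `D z₀ * Q = 0`, a factor `z - z₀` splits off on the range of the projection `Q`. This
  -- writes `D` as `G` times a matrix whose determinant is the expected power, and only `det (G z₀)
  -- ≠ 0` remains.
  let G : ℂ → Matrix ι ι ℂ := fun z => D z * (1 - Q) + E z * Q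
  have hGD : ∀ z, D z = G z * (1 - Q + (z - z₀) • Q) := by
    intro z
    have h1 : D z * Q = (z - z₀) • (E z * Q) := by
      conv_lhs => rw [hDE z]
      rw [Matrix.add_mul, hDQ, zero_add, Matrix.smul_mul]
    have h2 : (1 - Q) * (1 - Q) = 1 - Q := by
      rw [Matrix.mul_sub, Matrix.sub_mul, Matrix.sub_mul, hQQ]; simp
    have h3 : (1 - Q) * Q = 0 := by rw [Matrix.sub_mul, hQQ]; simp
    have h4 : Q * (1 - Q) = 0 := by rw [Matrix.mul_sub, hQQ]; simp
    simp only [G, Matrix.add_mul, Matrix.mul_add, Matrix.mul_assoc, Matrix.mul_smul, h2, h3, h4,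
      hQQ, Matrix.mul_zero, add_zero, zero_add]
    rw [← h1, ← Matrix.mul_add, sub_add_cancel, Matrix.mul_one]
  have hdet : ∀ z, (1 - Q + (z - z₀) • Q).det
      = (z - z₀) ^ Module.finrank ℂ (LinearMap.ker (Matrix.toLin' (D z₀))) := by
    intro z
    rw [← det_one_sub_add_smul_of_isProj hf, ← LinearMap.det_toLin']
    congr 1
    simp only [map_add, map_sub, map_smul, Matrix.toLin'_one, Q, Matrix.toLin'_toMatrix']
    rfl
  have hEd : ∀ i j, Differentiable ℂ fun z => E z i j := by
    intro i j
    have := (Complex.differentiableOn_dslope (f := fun z => D z i j) (c := z₀)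
      Filter.univ_mem).2 (hD i j).differentiableOn
    exact differentiableOn_univ.1 this
  have hGd : Differentiable ℂ fun z => (G z).det := by
    have : ∀ i j, Differentiable ℂ fun z => G z i j := by
      intro i j
      simp only [G, Matrix.add_apply, Matrix.mul_apply]
      fun_prop
    simp only [Matrix.det_apply]
    fun_prop
  have hDd : Differentiable ℂ fun z => (D z).det := by
    simp only [Matrix.det_apply]
    fun_prop
  rw [(hDd.analyticAt z₀).analyticOrderAt_eq_natCast]
  refine ⟨fun z => (G z).det, hGd.analyticAt z₀, ?_, Eventually.of_forall fun z => ?_⟩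
  -- A null vector `v` of `G z₀` makes `Q v` the start of a Jordan chain with `w = -v`. So `Q v =
  -- 0`, then `D z₀ v = 0`, and finally `v = Q v = 0`.
  · intro h0
    obtain ⟨v, hv0, hv⟩ := Matrix.exists_mulVec_eq_zero_iff.2 h0
    refine hv0 ?_
    have hv' : D z₀ *ᵥ v + E z₀ *ᵥ (Q *ᵥ v) = 0 := by
      have : G z₀ = D z₀ + E z₀ * Q := by
        simp only [G]
        rw [Matrix.mul_sub, hDQ, Matrix.mul_one, sub_zero]
      rw [Matrix.mulVec_mulVec, ← Matrix.add_mulVec, ← this]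
      exact hv
    have hDQv : D z₀ *ᵥ (Q *ᵥ v) = 0 := by rw [Matrix.mulVec_mulVec, hDQ, Matrix.zero_mulVec]
    have hQv : Q *ᵥ v = 0 := by
      refine hchain _ (-v) hDQv ?_
      rw [← hE0, Matrix.mulVec_neg]
      exact eq_neg_of_add_eq_zero_right hv'
    rw [hQv, Matrix.mulVec_zero, add_zero] at hv'
    have hker : f v = v := hf.map_id v hv'
    rw [← hker, ← hQ, hQv]
  · conv_lhs => rw [hGD z]
    rw [Matrix.det_mul, hdet, smul_eq_mul, mul_comm]

/-! ### Isotropy of the boundary space. -/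

/-- The boundary space of a self-adjoint boundary condition is isotropic. -/
theorem boundary_form_eq {m : ℕ} {M N : Mat m} (hrank : (Matrix.fromCols M N).rank = 2 * m)
    (hMN : M * J m * Mᴴ = N * J m * Nᴴ) {a b a' b' : Vec m} (h : M *ᵥ a = N *ᵥ b)
    (h' : M *ᵥ a' = N *ᵥ b') : star a' ⬝ᵥ (J m *ᵥ a) = star b' ⬝ᵥ (J m *ᵥ b) := by
  let F : Matrix (Fin m ⊕ Fin m) ((Fin m ⊕ Fin m) ⊕ (Fin m ⊕ Fin m)) ℂ := Matrix.fromCols M (-N)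
  -- `T` parametrises the boundary space `ker F`. Its range lies there by `hMN`; equality is a
  -- dimension count, as the rank condition makes `F` surjective and `T` injective.
  let T : Matrix ((Fin m ⊕ Fin m) ⊕ (Fin m ⊕ Fin m)) (Fin m ⊕ Fin m) ℂ :=
    Matrix.fromRows (J m * Mᴴ) (J m * Nᴴ)
  have hsurj : Function.Surjective (Matrix.toLin' (Matrix.fromCols M N)) := by
    rw [← LinearMap.range_eq_top]
    refine Submodule.eq_top_of_finrank_eq ?_
    have h1 : Module.finrank ℂ (LinearMap.range (Matrix.toLin' (Matrix.fromCols M N))) = 2 * m :=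
      hrank
    rw [h1, Module.finrank_fintype_fun_eq_card]
    simp [two_mul]
  have hFsurj : LinearMap.range (Matrix.toLin' F) = ⊤ := by
    rw [LinearMap.range_eq_top]
    intro y
    obtain ⟨x, hx⟩ := hsurj y
    refine ⟨Sum.elim (x ∘ Sum.inl) (-(x ∘ Sum.inr)), ?_⟩
    rw [Matrix.toLin'_apply, Matrix.fromCols_mulVec] at hx ⊢
    rw [← hx]
    simp [Matrix.neg_mulVec, Matrix.mulVec_neg]
  have hTinj : LinearMap.ker (Matrix.toLin' T) = ⊥ := by
    rw [LinearMap.ker_eq_bot']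
    intro c hc
    have hc' : T *ᵥ c = 0 := hc
    rw [Matrix.fromRows_mulVec] at hc'
    have h1 : (J m * Mᴴ) *ᵥ c = 0 := by
      ext i; exact congrFun hc' (Sum.inl i)
    have h2 : (J m * Nᴴ) *ᵥ c = 0 := by
      ext i; exact congrFun hc' (Sum.inr i)
    have hcancel : ∀ K : Mat m, (J m * K) *ᵥ c = 0 → K *ᵥ c = 0 := by
      intro K hK
      rw [← Matrix.mulVec_mulVec] at hK
      have := J_mulVec_J_mulVec (K *ᵥ c)
      rw [hK, Matrix.mulVec_zero] at this
      exact neg_eq_zero.1 this.symm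
    have h3 := hcancel _ h1
    have h4 := hcancel _ h2
    obtain ⟨x, hx⟩ := hsurj c
    rw [Matrix.toLin'_apply, Matrix.fromCols_mulVec] at hx
    have h5 : star c ⬝ᵥ c = 0 := by
      refine (congrArg (star c ⬝ᵥ ·) hx).symm.trans ?_
      rw [dotProduct_add, Matrix.dotProduct_mulVec, Matrix.dotProduct_mulVec]
      have e1 : star c ᵥ* M = 0 := by
        rw [← star_eq_zero, Matrix.star_vecMul, star_star, h3]
      have e2 : star c ᵥ* N = 0 := by
        rw [← star_eq_zero, Matrix.star_vecMul, star_star, h4]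
      rw [e1, e2, zero_dotProduct, zero_dotProduct, add_zero]
    exact dotProduct_star_self_eq_zero.1 h5
  have hle : LinearMap.range (Matrix.toLin' T) ≤ LinearMap.ker (Matrix.toLin' F) := by
    rintro _ ⟨c, rfl⟩
    rw [LinearMap.mem_ker, Matrix.toLin'_apply, Matrix.toLin'_apply, Matrix.mulVec_mulVec,
      Matrix.fromCols_mul_fromRows, Matrix.neg_mul, ← Matrix.mul_assoc, ← Matrix.mul_assoc, hMN,
      add_neg_cancel, Matrix.zero_mulVec]
  have heq : LinearMap.range (Matrix.toLin' T) = LinearMap.ker (Matrix.toLin' F) := by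
    refine Submodule.eq_of_le_of_finrank_eq hle ?_
    have h1 := LinearMap.finrank_range_add_finrank_ker (Matrix.toLin' F)
    have h2 := LinearMap.finrank_range_add_finrank_ker (Matrix.toLin' T)
    rw [hFsurj, finrank_top, Module.finrank_fintype_fun_eq_card,
      Module.finrank_fintype_fun_eq_card, Fintype.card_sum (α := Fin m ⊕ Fin m)] at h1
    rw [hTinj, finrank_bot, Module.finrank_fintype_fun_eq_card] at h2
    omega
  have hmem : Sum.elim a b ∈ LinearMap.ker (Matrix.toLin' F) := by
    rw [LinearMap.mem_ker, Matrix.toLin'_apply, Matrix.fromCols_mulVec, Sum.elim_comp_inl,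
      Sum.elim_comp_inr, Matrix.neg_mulVec, h, add_neg_cancel]
  rw [← heq] at hmem
  -- With `a = J M^* c` and `b = J N^* c`, the two forms are `-(M a')^* c` and `-(N b')^* c`, which
  -- agree by `h'`.
  obtain ⟨c, hc⟩ := hmem
  rw [Matrix.toLin'_apply, Matrix.fromRows_mulVec, Sum.elim_eq_iff] at hc
  rw [← hc.1, ← hc.2, ← Matrix.mulVec_mulVec, ← Matrix.mulVec_mulVec, J_mulVec_J_mulVec,
    J_mulVec_J_mulVec, dotProduct_neg, dotProduct_neg, Matrix.dotProduct_mulVec,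
    Matrix.dotProduct_mulVec, ← Matrix.star_mulVec, ← Matrix.star_mulVec, h']

/-! ### The Lagrange identity at both ends. -/

namespace System

variable {m : ℕ} (S : System m)

theorem summable_int_of_mem_preL2 {y : ℤ → Vec m} (h1 : y ∈ S.preL2 (Set.Iic 0))
    (h2 : y ∈ S.preL2 (Set.Ici 1)) : Summable fun n => (S.dens y y n).re := by
  refine Summable.of_nat_of_neg_add_one ?_ ?_
  · refine (summable_nat_add_iff 1).1 ?_
    have hmem : ∀ k : ℕ, ((k + 1 : ℕ) : ℤ) ∈ Set.Ici (1 : ℤ) := fun k => by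
      rw [Set.mem_Ici]; push_cast; omega
    exact (S.mem_preL2_iff.1 h2).comp_injective
      (i := fun k : ℕ => (⟨((k + 1 : ℕ) : ℤ), hmem k⟩ : Set.Ici (1 : ℤ))) (fun a b hab => by
        have := congrArg Subtype.val hab
        simp only at this
        omega)
  · have hmem : ∀ k : ℕ, -((k : ℤ) + 1) ∈ Set.Iic (0 : ℤ) := fun k => by
      rw [Set.mem_Iic]; omega
    exact (S.mem_preL2_iff.1 h1).comp_injective
      (i := fun k : ℕ => (⟨-((k : ℤ) + 1), hmem k⟩ : Set.Iic (0 : ℤ))) (fun a b hab =>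
        injective_neg_natCast_succ (congrArg Subtype.val hab))

/-- In the limit circle case at both ends all solutions are square summable. -/
theorem summable_dens_of_limitCircle (hB1 : S.CondB1) (hB2 : S.CondB2)
    (hbot : S.LimitCircleAtBot) (htop : S.LimitCircleAtTop) (lam : ℂ) (x : Vec m) :
    Summable fun n => (S.dens (S.sol lam x) (S.sol lam x) n).re := by
  obtain ⟨sl, tl, sr, tr, h1, h2, h3, h4, hdef⟩ := hB2
  have hl : S.IsDefiniteOn sl tl := fun lam y hy hne => (hdef lam y hy hne).1
  have hr : S.IsDefiniteOn sr tr := fun lam y hy hne => (hdef lam y hy hne).2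
  have hlI : Set.Icc sl tl ⊆ Set.Iic (0 : ℤ) := fun n hn => hn.2.trans h2
  have hrI : Set.Icc sr tr ⊆ Set.Ici (1 : ℤ) := fun n hn => h3.trans hn.1
  -- The defect index at `mu` controls the solutions for `star mu`; the indices at both `i` and `-i`
  -- are needed because `summable_dens_sol` starts from a conjugate pair.
  have key : ∀ mu : ℂ, defectIndex (S.minimal (Set.Iic 0)) mu = ((2 * m : ℕ) : Cardinal) →
      defectIndex (S.minimal (Set.Ici 1)) mu = ((2 * m : ℕ) : Cardinal) →
      Summable (S.totalDens (star mu)) := fun mu hmu hmu' =>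
    summable_sum fun j _ => S.summable_int_of_mem_preL2
      (S.sol_mem_preL2_of_defectIndex hB1 mu Set.ordConnected_Iic h1 hlI hl hmu _)
      (S.sol_mem_preL2_of_defectIndex hB1 mu Set.ordConnected_Ici h4 hrI hr hmu' _)
  have hI : star (-Complex.I) = Complex.I := by simp
  refine S.summable_dens_sol hB1 (mu := Complex.I) ?_ (key _ hbot.1 htop.1) lam x
  rw [← hI]
  exact key _ hbot.2 htop.2

/-- The summed Lagrange identity. Keeping the factor `lam - star mu` in front lets it be evaluated,
or differentiated in `lam`, where that factor vanishes. -/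
theorem bracket_sol_natCast (h : S.CondB1) (lam mu : ℂ) (x w : Vec m) (k : ℕ) :
    bracket (S.sol lam x) (S.sol mu w) k = star w ⬝ᵥ (J m *ᵥ x)
      + (lam - star mu) * ∑ j ∈ Finset.range k, S.dens (S.sol mu w) (S.sol lam x) j := by
  induction k with
  | zero => simp [bracket, sol_zero]
  | succ k ih =>
    have := S.bracket_succ_sub_of_isSolution (S.sol_isSolution h lam x) (S.sol_isSolution h mu w) k
    rw [Finset.sum_range_succ, mul_add, ← this, ← add_assoc, ← ih]
    push_cast
    ring

theorem bracket_sol_neg_natCast (h : S.CondB1) (lam mu : ℂ) (x w : Vec m) (k : ℕ) :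
    bracket (S.sol lam x) (S.sol mu w) (-k) = star w ⬝ᵥ (J m *ᵥ x) + (lam - star mu)
      * -∑ j ∈ Finset.range k, S.dens (S.sol mu w) (S.sol lam x) (-((j : ℤ) + 1)) := by
  induction k with
  | zero => simp [bracket, sol_zero]
  | succ k ih =>
    have := S.bracket_succ_sub_of_isSolution (S.sol_isSolution h lam x) (S.sol_isSolution h mu w)
      (-((k : ℤ) + 1))
    rw [neg_natCast_succ_add_one] at this
    rw [Finset.sum_range_succ, neg_add, mul_add, mul_neg _ (S.dens _ _ _), ← this, ← add_assoc,
      ← ih]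
    push_cast
    ring

theorem tendsto_star_dotProduct_mulVec {ι α : Type*} [Fintype ι] (Q : Matrix ι ι ℂ)
    {l : Filter α} {f g : α → ι → ℂ} {a b : ι → ℂ} (hf : Tendsto f l (𝓝 a))
    (hg : Tendsto g l (𝓝 b)) :
    Tendsto (fun k => star (f k) ⬝ᵥ (Q *ᵥ g k)) l (𝓝 (star a ⬝ᵥ (Q *ᵥ b))) := by
  simp only [dotProduct, Matrix.mulVec]
  exact tendsto_finsetSum _ fun i _ => (tendsto_pi_nhds.1 hf i).star.mul
    (tendsto_finsetSum _ fun j _ => (tendsto_pi_nhds.1 hg j).const_mul _)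

theorem tendsto_bracket_natCast (h : S.CondB1) (h0 : Summable (S.totalDens 0)) (lam mu : ℂ)
    (x w : Vec m) : Tendsto (fun k : ℕ => bracket (S.sol lam x) (S.sol mu w) k) atTop
      (𝓝 (star (S.ThetaTop mu *ᵥ w) ⬝ᵥ (J m *ᵥ (S.ThetaTop lam *ᵥ x)))) := by
  simp only [S.bracket_sol_eq_Theta h]
  exact tendsto_star_dotProduct_mulVec (J m) (S.tendsto_Theta_natCast h h0 mu w)
    (S.tendsto_Theta_natCast h h0 lam x)

theorem tendsto_bracket_neg_natCast (h : S.CondB1) (h0 : Summable (S.totalDens 0)) (lam mu : ℂ)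
    (x w : Vec m) : Tendsto (fun k : ℕ => bracket (S.sol lam x) (S.sol mu w) (-k)) atTop
      (𝓝 (star (S.ThetaBot mu *ᵥ w) ⬝ᵥ (J m *ᵥ (S.ThetaBot lam *ᵥ x)))) := by
  simp only [S.bracket_sol_eq_Theta h]
  exact tendsto_star_dotProduct_mulVec (J m) (S.tendsto_Theta_neg_natCast h h0 mu w)
    (S.tendsto_Theta_neg_natCast h h0 lam x)

/-- Derivative of `(lam - mu) * g lam` at `mu`. -/
theorem hasDerivAt_const_add_sub_mul {g : ℂ → ℂ} (hg : Differentiable ℂ g) (c mu : ℂ) :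
    HasDerivAt (fun lam => c + (lam - mu) * g lam) (g mu) mu := by
  have := (((hasDerivAt_id mu).sub_const mu).mul (hg mu).hasDerivAt).const_add c
  simpa using this

theorem hasDerivAt_boundary_form (a : Vec m) {g : ℂ → Vec m} {g' : Vec m} {mu : ℂ}
    (hg : HasDerivAt g g' mu) :
    HasDerivAt (fun lam => star a ⬝ᵥ (J m *ᵥ g lam)) (star a ⬝ᵥ (J m *ᵥ g')) mu := by
  let φ : Vec m →ₗ[ℂ] ℂ :=
    { toFun := fun v => star a ⬝ᵥ (J m *ᵥ v)
      map_add' := fun v w => by rw [Matrix.mulVec_add, dotProduct_add]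
      map_smul' := fun c v => by simp [Matrix.mulVec_smul] }
  exact (LinearMap.toContinuousLinearMap φ).hasFDerivAt.comp_hasDerivAt mu hg

theorem differentiable_dens_sol (z : ℤ → Vec m) (x : Vec m) (n : ℤ) :
    Differentiable ℂ fun lam => S.dens z (S.sol lam x) n := by
  have h1 : ∀ k i, Differentiable ℂ fun lam => S.sol lam x k i :=
    fun k i => differentiable_pi.1 (S.differentiable_sol x k) i
  have h2 : ∀ i, Differentiable ℂ fun lam => R (S.sol lam x) n i := by
    rintro (i | i)
    · exact h1 (n + 1) (Sum.inl i)
    · exact h1 n (Sum.inr i)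
  simp only [dens, Matrix.mulVec, dotProduct]
  fun_prop

/-- Differentiate the Lagrange identity in `lam` at the real point `mu`, with the second solution
fixed: the factor `lam - mu` vanishes there, so only the sum of densities survives. -/
theorem boundary_form_deriv_natCast (h : S.CondB1) {mu : ℂ} (hmu : star mu = mu) (x : Vec m)
    (k : ℕ) : star (S.Theta mu k *ᵥ x) ⬝ᵥ (J m *ᵥ deriv (fun lam => S.Theta lam k *ᵥ x) mu)
      = ∑ j ∈ Finset.range k, S.dens (S.sol mu x) (S.sol mu x) j := by
  have h1 := hasDerivAt_boundary_form (S.Theta mu k *ᵥ x)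
    (S.differentiable_Theta_mulVec h x k mu).hasDerivAt
  simp only [← S.bracket_sol_eq_Theta h, S.bracket_sol_natCast h, hmu] at h1
  refine h1.unique (hasDerivAt_const_add_sub_mul
    (g := fun lam => ∑ j ∈ Finset.range k, S.dens (S.sol mu x) (S.sol lam x) j) ?_ _ mu)
  exact Differentiable.fun_sum fun j _ => S.differentiable_dens_sol _ x j

theorem boundary_form_deriv_neg_natCast (h : S.CondB1) {mu : ℂ} (hmu : star mu = mu) (x : Vec m)
    (k : ℕ) : star (S.Theta mu (-k) *ᵥ x) ⬝ᵥ (J m *ᵥ deriv (fun lam => S.Theta lam (-k) *ᵥ x) mu)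
      = -∑ j ∈ Finset.range k, S.dens (S.sol mu x) (S.sol mu x) (-((j : ℤ) + 1)) := by
  have h1 := hasDerivAt_boundary_form (S.Theta mu (-k) *ᵥ x)
    (S.differentiable_Theta_mulVec h x (-k) mu).hasDerivAt
  simp only [← S.bracket_sol_eq_Theta h, S.bracket_sol_neg_natCast h, hmu] at h1
  refine h1.unique (hasDerivAt_const_add_sub_mul (g := fun lam =>
    -∑ j ∈ Finset.range k, S.dens (S.sol mu x) (S.sol lam x) (-((j : ℤ) + 1))) ?_ _ mu)
  exact (Differentiable.fun_sum fun j _ => S.differentiable_dens_sol _ x _).neg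

theorem differentiable_ThetaTop_mulVec (h : S.CondB1) (h0 : Summable (S.totalDens 0))
    (x : Vec m) : Differentiable ℂ fun lam => S.ThetaTop lam *ᵥ x :=
  differentiableOn_univ.1 ((S.tendstoLocallyUniformly_Theta_top h h0
    x).tendstoLocallyUniformlyOn.differentiableOn (Eventually.of_forall fun k =>
      (S.differentiable_Theta_mulVec h x k).differentiableOn) isOpen_univ)

theorem differentiable_ThetaBot_mulVec (h : S.CondB1) (h0 : Summable (S.totalDens 0))
    (x : Vec m) : Differentiable ℂ fun lam => S.ThetaBot lam *ᵥ x :=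
  differentiableOn_univ.1 ((S.tendstoLocallyUniformly_Theta_bot h h0
    x).tendstoLocallyUniformlyOn.differentiableOn (Eventually.of_forall fun k =>
      (S.differentiable_Theta_mulVec h x (-k)).differentiableOn) isOpen_univ)

theorem tendsto_deriv_Theta_top (h : S.CondB1) (h0 : Summable (S.totalDens 0)) (mu : ℂ)
    (x : Vec m) : Tendsto (fun k : ℕ => deriv (fun lam => S.Theta lam k *ᵥ x) mu) atTop
      (𝓝 (deriv (fun lam => S.ThetaTop lam *ᵥ x) mu)) :=
  ((S.tendstoLocallyUniformly_Theta_top h h0 x).tendstoLocallyUniformlyOn.deriv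
    (Eventually.of_forall fun k => (S.differentiable_Theta_mulVec h x k).differentiableOn)
    isOpen_univ).tendsto_at (Set.mem_univ mu)

theorem tendsto_deriv_Theta_bot (h : S.CondB1) (h0 : Summable (S.totalDens 0)) (mu : ℂ)
    (x : Vec m) : Tendsto (fun k : ℕ => deriv (fun lam => S.Theta lam (-k) *ᵥ x) mu) atTop
      (𝓝 (deriv (fun lam => S.ThetaBot lam *ᵥ x) mu)) :=
  ((S.tendstoLocallyUniformly_Theta_bot h h0 x).tendstoLocallyUniformlyOn.deriv
    (Eventually.of_forall fun k => (S.differentiable_Theta_mulVec h x (-k)).differentiableOn)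
    isOpen_univ).tendsto_at (Set.mem_univ mu)

/-! ### The boundary matrix: real kernel parameters and no Jordan chains. -/

/-- The matrix of the boundary value problem, whose determinant is `Gamma`. -/
def bvpMatrix (M N : Mat m) (lam : ℂ) : Mat m := M * S.ThetaBot lam - N * S.ThetaTop lam

theorem bvpMatrix_mulVec (M N : Mat m) (lam : ℂ) (x : Vec m) :
    S.bvpMatrix M N lam *ᵥ x = M *ᵥ (S.ThetaBot lam *ᵥ x) - N *ᵥ (S.ThetaTop lam *ᵥ x) := by
  rw [bvpMatrix, Matrix.sub_mulVec, ← Matrix.mulVec_mulVec, ← Matrix.mulVec_mulVec]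

theorem hasDerivAt_mulVec (M : Mat m) {g : ℂ → Vec m} {g' : Vec m} {mu : ℂ}
    (hg : HasDerivAt g g' mu) : HasDerivAt (fun lam => M *ᵥ g lam) (M *ᵥ g') mu :=
  (LinearMap.toContinuousLinearMap (Matrix.toLin' M)).hasFDerivAt.comp_hasDerivAt mu hg

theorem hasDerivAt_bvpMatrix_mulVec (h : S.CondB1) (h0 : Summable (S.totalDens 0)) (M N : Mat m)
    (mu : ℂ) (x : Vec m) : HasDerivAt (fun lam => S.bvpMatrix M N lam *ᵥ x)
      (M *ᵥ deriv (fun lam => S.ThetaBot lam *ᵥ x) mu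
        - N *ᵥ deriv (fun lam => S.ThetaTop lam *ᵥ x) mu) mu := by
  simp only [bvpMatrix_mulVec]
  exact (hasDerivAt_mulVec M (S.differentiable_ThetaBot_mulVec h h0 x mu).hasDerivAt).sub
    (hasDerivAt_mulVec N (S.differentiable_ThetaTop_mulVec h h0 x mu).hasDerivAt)

theorem differentiable_bvpMatrix (h : S.CondB1) (h0 : Summable (S.totalDens 0)) (M N : Mat m)
    (i j : Fin m ⊕ Fin m) : Differentiable ℂ fun lam => S.bvpMatrix M N lam i j := by
  intro mu
  have h1 := (S.hasDerivAt_bvpMatrix_mulVec h h0 M N mu (Pi.single j 1)).differentiableAt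
  simpa using differentiableAt_pi.1 h1 i

theorem deriv_bvpMatrix_mulVec (h : S.CondB1) (h0 : Summable (S.totalDens 0)) (M N : Mat m)
    (mu : ℂ) (x : Vec m) :
    (Matrix.of fun i j => deriv (fun lam => S.bvpMatrix M N lam i j) mu) *ᵥ x
      = M *ᵥ deriv (fun lam => S.ThetaBot lam *ᵥ x) mu
        - N *ᵥ deriv (fun lam => S.ThetaTop lam *ᵥ x) mu := by
  ext i
  have h1 := hasDerivAt_pi.1 (S.hasDerivAt_bvpMatrix_mulVec h h0 M N mu x) i
  refine HasDerivAt.unique ?_ h1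
  simp only [Matrix.mulVec, dotProduct, Matrix.of_apply]
  exact HasDerivAt.fun_sum fun j _ =>
    ((S.differentiable_bvpMatrix h h0 M N i j) mu).hasDerivAt.mul_const _

/-- The mass of a sequence on the nonnegative integers. -/
def massTop (y : ℤ → Vec m) : ℝ := ∑' j : ℕ, (S.dens y y j).re

/-- The mass of a sequence on the negative integers. -/
def massBot (y : ℤ → Vec m) : ℝ := ∑' j : ℕ, (S.dens y y (-((j : ℤ) + 1))).re

theorem massBot_nonneg (y : ℤ → Vec m) : 0 ≤ S.massBot y :=
  tsum_nonneg fun _ => S.dens_self_nonneg _ _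

theorem tendsto_massTop {y : ℤ → Vec m} (hy : Summable fun n => (S.dens y y n).re) :
    Tendsto (fun k : ℕ => ∑ j ∈ Finset.range k, S.dens y y j) atTop (𝓝 (S.massTop y : ℂ)) := by
  have h := (hy.comp_injective (i := fun k : ℕ => (k : ℤ))
    Nat.cast_injective).hasSum.tendsto_sum_nat
  have h' := (Complex.continuous_ofReal.tendsto _).comp h
  refine h'.congr fun k => ?_
  simp only [Function.comp_apply, Complex.ofReal_sum, ofReal_dens_self]

theorem tendsto_massBot {y : ℤ → Vec m} (hy : Summable fun n => (S.dens y y n).re) :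
    Tendsto (fun k : ℕ => ∑ j ∈ Finset.range k, S.dens y y (-((j : ℤ) + 1))) atTop
      (𝓝 (S.massBot y : ℂ)) := by
  have h := (hy.comp_injective injective_neg_natCast_succ).hasSum.tendsto_sum_nat
  have h' := (Complex.continuous_ofReal.tendsto _).comp h
  refine h'.congr fun k => ?_
  simp only [Function.comp_apply, Complex.ofReal_sum, ofReal_dens_self]

theorem massTop_pos (h : S.CondB1) {p q : ℤ} (hp : 0 ≤ p) (hdef : S.IsDefiniteOn p q) (lam : ℂ)
    {x : Vec m} (hx : x ≠ 0)
    (hsum : Summable fun n => (S.dens (S.sol lam x) (S.sol lam x) n).re) :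
    0 < S.massTop (S.sol lam x) := by
  have h1 : ∃ n ∈ Set.Icc p q, S.W n *ᵥ R (S.sol lam x) n ≠ 0 := by
    by_contra! hcon
    exact hx (S.eq_zero_of_definite h hdef lam x hcon)
  obtain ⟨n, hn, hne⟩ := h1
  obtain ⟨k, rfl⟩ := Int.eq_ofNat_of_zero_le (hp.trans hn.1)
  refine (hsum.comp_injective (i := fun k : ℕ => (k : ℤ)) Nat.cast_injective).tsum_pos
    (fun j => S.dens_self_nonneg _ _) k ?_
  exact lt_of_le_of_ne (S.dens_self_nonneg _ _) fun h' => hne (S.dens_eq_zero_iff.1 h'.symm)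

theorem summable_totalDens
    (hsum : ∀ (lam : ℂ) (x : Vec m), Summable fun n => (S.dens (S.sol lam x) (S.sol lam x) n).re)
    (lam : ℂ) : Summable (S.totalDens lam) :=
  summable_sum fun _ _ => hsum lam _

/-- Isotropy equates the brackets of the solution with itself at both ends, so the Lagrange identity
gives `(lam - star lam)` times the total mass equal to 0, and the mass is positive. -/
theorem star_eq_self_of_bvpMatrix_mulVec_eq_zero (hB1 : S.CondB1)
    (hsum : ∀ (lam : ℂ) (x : Vec m), Summable fun n => (S.dens (S.sol lam x) (S.sol lam x) n).re)
    {p q : ℤ} (hp : 0 ≤ p) (hdef : S.IsDefiniteOn p q) {M N : Mat m}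
    (hrank : (Matrix.fromCols M N).rank = 2 * m) (hMN : M * J m * Mᴴ = N * J m * Nᴴ)
    {lam : ℂ} {x : Vec m} (hx : x ≠ 0)
    (h : S.bvpMatrix M N lam *ᵥ x = 0) : star lam = lam := by
  have h0 := S.summable_totalDens hsum 0
  rw [bvpMatrix_mulVec, sub_eq_zero] at h
  have hform := boundary_form_eq hrank hMN h h
  have h1 := tendsto_nhds_unique (S.tendsto_bracket_natCast hB1 h0 lam lam x x) (by
    simp only [S.bracket_sol_natCast hB1]
    exact ((S.tendsto_massTop (hsum lam x)).const_mul _).const_add _)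
  have h2 := tendsto_nhds_unique (S.tendsto_bracket_neg_natCast hB1 h0 lam lam x x) (by
    simp only [S.bracket_sol_neg_natCast hB1]
    exact ((S.tendsto_massBot (hsum lam x)).neg.const_mul _).const_add _)
  rw [h1, h2] at hform
  have h3 : (lam - star lam) * ((S.massTop (S.sol lam x) + S.massBot (S.sol lam x) : ℝ) : ℂ)
      = 0 := by
    push_cast
    linear_combination -hform
  have hpos := S.massTop_pos hB1 hp hdef lam hx (hsum lam x)
  have hnn := S.massBot_nonneg (S.sol lam x)
  rcases mul_eq_zero.1 h3 with h4 | h4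
  · exact (sub_eq_zero.1 h4).symm
  · rw [Complex.ofReal_eq_zero] at h4
    linarith

/-- A chain places the boundary values `Θ' v - Θ w` in the same isotropic space as `Θ v`. Their
pairing reduces to the total mass of the solution with initial value `v`, which must therefore
vanish. -/
theorem eq_zero_of_jordan_chain (hB1 : S.CondB1)
    (hsum : ∀ (lam : ℂ) (x : Vec m), Summable fun n => (S.dens (S.sol lam x) (S.sol lam x) n).re)
    {p q : ℤ} (hp : 0 ≤ p) (hdef : S.IsDefiniteOn p q) {M N : Mat m}
    (hrank : (Matrix.fromCols M N).rank = 2 * m) (hMN : M * J m * Mᴴ = N * J m * Nᴴ)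
    {lam : ℂ} {v w : Vec m} (hv : S.bvpMatrix M N lam *ᵥ v = 0)
    (hw : (Matrix.of fun i j => deriv (fun z => S.bvpMatrix M N z i j) lam) *ᵥ v
      = S.bvpMatrix M N lam *ᵥ w) : v = 0 := by
  by_contra hne
  have hreal := S.star_eq_self_of_bvpMatrix_mulVec_eq_zero hB1 hsum hp hdef hrank hMN hne hv
  have h0 := S.summable_totalDens hsum 0
  rw [S.deriv_bvpMatrix_mulVec hB1 h0, bvpMatrix_mulVec] at hw
  rw [bvpMatrix_mulVec, sub_eq_zero] at hv
  set tb := deriv (fun z => S.ThetaBot z *ᵥ v) lam with htb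
  set tt := deriv (fun z => S.ThetaTop z *ᵥ v) lam with htt
  have hw' : M *ᵥ (tb - S.ThetaBot lam *ᵥ w) = N *ᵥ (tt - S.ThetaTop lam *ᵥ w) := by
    rw [Matrix.mulVec_sub, Matrix.mulVec_sub]
    linear_combination hw
  have hform := boundary_form_eq hrank hMN hw' hv
  -- For real `lam` the bracket of two solutions is constant in `n`, so the contributions of `w` at
  -- the two ends coincide and cancel.
  have hct : star (S.ThetaTop lam *ᵥ v) ⬝ᵥ (J m *ᵥ (S.ThetaTop lam *ᵥ w))
      = star v ⬝ᵥ (J m *ᵥ w) := by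
    refine tendsto_nhds_unique (S.tendsto_bracket_natCast hB1 h0 lam lam w v) ?_
    simp only [S.bracket_sol_natCast hB1, hreal, sub_self, zero_mul, add_zero]
    exact tendsto_const_nhds
  have hcb : star (S.ThetaBot lam *ᵥ v) ⬝ᵥ (J m *ᵥ (S.ThetaBot lam *ᵥ w))
      = star v ⬝ᵥ (J m *ᵥ w) := by
    refine tendsto_nhds_unique (S.tendsto_bracket_neg_natCast hB1 h0 lam lam w v) ?_
    simp only [S.bracket_sol_neg_natCast hB1, hreal, sub_self, zero_mul, add_zero]
    exact tendsto_const_nhds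
  have hdt : star (S.ThetaTop lam *ᵥ v) ⬝ᵥ (J m *ᵥ tt) = S.massTop (S.sol lam v) := by
    refine tendsto_nhds_unique (tendsto_star_dotProduct_mulVec (J m)
      (S.tendsto_Theta_natCast hB1 h0 lam v) (S.tendsto_deriv_Theta_top hB1 h0 lam v)) ?_
    simp only [S.boundary_form_deriv_natCast hB1 hreal]
    exact S.tendsto_massTop (hsum lam v)
  have hdb : star (S.ThetaBot lam *ᵥ v) ⬝ᵥ (J m *ᵥ tb) = -S.massBot (S.sol lam v) := by
    refine tendsto_nhds_unique (tendsto_star_dotProduct_mulVec (J m)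
      (S.tendsto_Theta_neg_natCast hB1 h0 lam v) (S.tendsto_deriv_Theta_bot hB1 h0 lam v)) ?_
    simp only [S.boundary_form_deriv_neg_natCast hB1 hreal]
    exact (S.tendsto_massBot (hsum lam v)).neg
  rw [Matrix.mulVec_sub, Matrix.mulVec_sub, dotProduct_sub, dotProduct_sub, hct, hcb, hdt, hdb]
    at hform
  have h3 : ((S.massTop (S.sol lam v) + S.massBot (S.sol lam v) : ℝ) : ℂ) = 0 := by
    push_cast
    linear_combination -hform
  rw [Complex.ofReal_eq_zero] at h3
  have hpos := S.massTop_pos hB1 hp hdef lam hne (hsum lam v)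
  have hnn := S.massBot_nonneg (S.sol lam v)
  linarith

/-! ### Eigenspaces as kernels of the boundary matrix. -/

theorem mem_preL2_univ {y : ℤ → Vec m} (hy : Summable fun n => (S.dens y y n).re) :
    y ∈ S.preL2 Set.univ :=
  S.mem_preL2_iff.2 (hy.comp_injective Subtype.val_injective)

/-- The class in `l²_W(ℤ)` of the solution with given initial value. -/
def solCls (h : S.CondB1) (lam : ℂ)
    (hsum : ∀ x : Vec m, Summable fun n => (S.dens (S.sol lam x) (S.sol lam x) n).re) :
    Vec m →ₗ[ℂ] S.L2 Set.univ :=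
  (S.cls Set.univ).comp (show Vec m →ₗ[ℂ] S.preL2 Set.univ from
    (S.solLin h lam).codRestrict (S.preL2 Set.univ) fun x => S.mem_preL2_univ (hsum x))

theorem solCls_apply (h : S.CondB1) (lam : ℂ)
    (hsum : ∀ x : Vec m, Summable fun n => (S.dens (S.sol lam x) (S.sol lam x) n).re)
    (x : Vec m) : S.solCls h lam hsum x
      = S.cls Set.univ (S.mkPreL2 Set.univ (S.sol lam x) (S.mem_preL2_univ (hsum x))) := rfl

theorem solCls_injective (h : S.CondB1) {p q : ℤ} (hdef : S.IsDefiniteOn p q) (lam : ℂ)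
    (hsum : ∀ x : Vec m, Summable fun n => (S.dens (S.sol lam x) (S.sol lam x) n).re) :
    Function.Injective (S.solCls h lam hsum) := by
  rw [← LinearMap.ker_eq_bot, LinearMap.ker_eq_bot']
  intro x hx
  rw [solCls_apply, cls_eq_zero_iff] at hx
  exact S.eq_zero_of_definite h hdef lam x fun n _ => hx n (Set.mem_univ n)

theorem mem_boundaryCondition_sol_iff (h : S.CondB1) (h0 : Summable (S.totalDens 0)) (M N : Mat m)
    (lam : ℂ) (x : Vec m) :
    S.sol lam x ∈ S.boundaryCondition M N ↔ S.bvpMatrix M N lam *ᵥ x = 0 := by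
  have hb := tendsto_mulVec (S.tendsto_Theta_bot h h0 lam) x
  have ht := tendsto_mulVec (S.tendsto_Theta_top h h0 lam) x
  simp only [← S.bracket_sol_theta h] at hb ht
  rw [bvpMatrix_mulVec]
  constructor
  · rintro ⟨a, b, ha, hb', hab⟩
    rw [← tendsto_nhds_unique ha hb, ← tendsto_nhds_unique hb' ht]
    exact hab
  · intro hx
    exact ⟨_, _, hb, ht, hx⟩

/-- The relation is tested against every representative of `lam • f`, in particular against `lam •
y` for the chosen representative `y` of `f`. So `y` solves the system at every node and is
determined by `y 0`, on which the boundary condition becomes a linear equation. -/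
theorem eigenspace_TD_eq (h : S.CondB1) (h0 : Summable (S.totalDens 0)) (M N : Mat m) (lam : ℂ)
    (hsum : ∀ x : Vec m, Summable fun n => (S.dens (S.sol lam x) (S.sol lam x) n).re) :
    eigenspace (S.TD M N) lam
      = (LinearMap.ker (Matrix.toLin' (S.bvpMatrix M N lam))).map (S.solCls h lam hsum) := by
  ext f
  rw [Submodule.mem_map]
  constructor
  · intro hf
    obtain ⟨y, hy, hyD, hyg⟩ : (f, lam • f) ∈ S.TD M N := hf
    have hsol : S.IsSolution lam (S.seq Set.univ y) := by
      rw [isSolution_iff]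
      intro n
      have := hyg (lam • y) (by rw [map_smul, hy]) n (Set.mem_univ n)
      rw [this, map_smul, R_smul, Matrix.mulVec_smul]
    have hyx := S.eq_sol h hsol
    rw [hyx, S.mem_boundaryCondition_sol_iff h h0] at hyD
    refine ⟨S.seq Set.univ y 0, hyD, ?_⟩
    rw [solCls_apply]
    refine Eq.trans ?_ hy
    congr 1
    exact Subtype.ext hyx.symm
  · rintro ⟨x, hx, rfl⟩
    have hx' : S.bvpMatrix M N lam *ᵥ x = 0 := hx
    change (S.solCls h lam hsum x, lam • S.solCls h lam hsum x) ∈ S.TD M N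
    refine ⟨_, rfl, (S.mem_boundaryCondition_sol_iff h h0 M N lam x).2 hx', fun g hg n hn => ?_⟩
    rw [solCls_apply, ← map_smul, ← sub_eq_zero, ← map_sub] at hg
    have h1 := S.cls_eq_zero_iff.1 hg n hn
    rw [map_sub, map_smul, R_sub, R_smul, Matrix.mulVec_sub, sub_eq_zero, Matrix.mulVec_smul] at h1
    rw [h1]
    exact S.isSolution_iff.1 (S.sol_isSolution h lam x) n

end System

end DiscreteHamiltonian

end

theorem theorem4p1 {m : ℕ} (S : DiscreteHamiltonian.System m)
    (hB1 : S.CondB1) (hB2 : S.CondB2)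
    (hbot : S.LimitCircleAtBot) (htop : S.LimitCircleAtTop)
    (M N : DiscreteHamiltonian.Mat m)
    (hrank : (Matrix.fromCols M N).rank = 2 * m)
    (hMN : M * DiscreteHamiltonian.J m * Mᴴ = N * DiscreteHamiltonian.J m * Nᴴ) :
    (∀ lam : ℂ, Tendsto (S.Theta lam) atBot (𝓝 (S.ThetaBot lam)) ∧
      Tendsto (S.Theta lam) atTop (𝓝 (S.ThetaTop lam))) ∧
    Differentiable ℂ (S.Gamma M N) ∧
    ∀ lam : ℂ, DiscreteHamiltonian.IsEigenvalue (S.TD M N) lam →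
      FiniteDimensional ℂ (DiscreteHamiltonian.eigenspace (S.TD M N) lam) ∧
      analyticOrderAt (S.Gamma M N) lam =
        (Module.finrank ℂ (DiscreteHamiltonian.eigenspace (S.TD M N) lam) : ℕ∞) := by
  have hsum := S.summable_dens_of_limitCircle hB1 hB2 hbot htop
  have h0 := S.summable_totalDens hsum 0
  obtain ⟨sl, tl, sr, tr, -, -, hsr, -, hdef⟩ := hB2
  have hdef' : S.IsDefiniteOn sr tr := fun lam y hy hne => (hdef lam y hy hne).2
  have hentry := S.differentiable_bvpMatrix hB1 h0 M N
  refine ⟨fun lam => ⟨S.tendsto_Theta_bot hB1 h0 lam, S.tendsto_Theta_top hB1 h0 lam⟩, ?_,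
    fun lam _ => ?_⟩
  · change Differentiable ℂ fun lam => (S.bvpMatrix M N lam).det
    simp only [Matrix.det_apply]
    fun_prop
  · rw [S.eigenspace_TD_eq hB1 h0 M N lam (hsum lam)]
    refine ⟨inferInstance, ?_⟩
    rw [← (Submodule.equivMapOfInjective _
      (S.solCls_injective hB1 hdef' lam (hsum lam)) _).finrank_eq]
    exact DiscreteHamiltonian.analyticOrderAt_det_eq_finrank_ker hentry lam fun v w hv hw =>
      S.eq_zero_of_jordan_chain hB1 hsum (by omega) hdef' hrank hMN hv hw
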